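/- Let $S$ be a nonempty closed topological surface with a finite cellular decomposition $\Sigma=(V,E,F)$ in which every 2-cell has a 1-cell on its boundary, and let $\Phi:E\to(0,\frac{\pi}{2})$ be a weight. Choose an auxiliary point in every 2-cell and join it to the vertices on the boundary of that 2-cell; this cuts $S$ into quadrilaterals $Q(e)$, $e\in E$, whose vertices are the end points of $e$ and the auxiliary points of the 2-cells on the two sides of $e$. For radii $\mathbf r=(r_f)_{f\in F}\in(0,\frac{\pi}{2}]^{F}$, identify every $Q(e)$ with the spherical quadrilateral spanned by the centres and the two boundary intersection points of two disks in the unit sphere $\mathbb S^2$ that have the radii of the 2-cells on the two sides of $e$ and whose intersection is a bigon with interior angle $\Phi(e)$; gluing these quadrilaterals isometrically along their sides gives a spherical conical metric on $S$ with a circle pattern (one immersed disk of radius $r_f$ for each 2-cell $f$). It is called a degenerated circle pattern metric if $r_f=\frac{\pi}{2}$ for at least one $f\in F$, i.e. if some geodesic curvature $k_f=\cot r_f$ is $0$. Its total geodesic curvature is the vector $L=(L_f)_{f\in F}$ with $L_f=\sum_e \ell_{f,e}k_f$, the sum being over the sides of 1-cells that lie on $\partial f$ (a 1-cell with $f$ on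 both sides is counted twice), where $\ell_{f,e}$ is the length of the corresponding side, on the boundary circle of the disk of $f$, of the bigon belonging to $e$. For $F'\subset F$ let $E_{F'}$ be the set of 1-cells that lie on the boundary of some $f\in F'$. For a nonempty proper subset $I\subsetneq F$ put $$\mathcal L_I=\Big\{L\in\mathbb R^{F}\ \Big|\ L_f=0\ (f\notin I),\ L_f>0\ (f\in I),\ \sum_{f\in F'}L_f<2\sum_{e\in E_{F'}}\Phi(e)\ \text{ for all } \emptyset\ne F'\subset I\Big\},$$ and let $$\bar\partial\mathcal L=\{0\}\cup\bigcup_{\emptyset\ne I\subsetneq F}\mathcal L_I .$$ Then for every $\hat L\in\mathbb R^{F}$ there exists a degenerated circle pattern metric on $S$ with total geodesic curvature $\hat L$ if and only if $\hat L\in\bar\partial\mathcal L$. Moreover, this metric is unique up to isometry if it exists: any two such metrics have the same radii, and there is an isometry between them that carries one circle pattern to the other, maps every $Q(e)$ to itself and fixes the vertices and the auxiliary points. -/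

import Mathlib

open scoped ENNReal

noncomputable section

namespace SphericalPattern

/-! ### Cellular decompositions of closed surfaces -/

/-- The model quadrilateral `|x| + |y| ≤ 1`.  Its corners `(-1, 0)`, `(1, 0)` stand for the auxiliary
points of the two 2-cells beside a 1-cell, its corners `(0, -1)`, `(0, 1)` for the two end points of
the 1-cell, and the vertical diagonal for the 1-cell itself. -/
abbrev Square : Type := {x : ℝ × ℝ // |x.1| + |x.2| ≤ 1}

/-- `false ↦ -1`, `true ↦ 1`. -/
def sgn (b : Bool) : ℝ := cond b 1 (-1)

theorem abs_sgn (b : Bool) : |sgn b| = 1 := by cases b <;> simp [sgn]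

/-- The side of the model quadrilateral from the auxiliary point on side `s` (parameter `0`) to the
end point `t` (parameter `1`). -/
def leg (s t : Bool) (c : unitInterval) : Square :=
  ⟨((1 - (c : ℝ)) * sgn s, (c : ℝ) * sgn t), by
    have h0 := c.2.1
    have h1 := c.2.2
    simp only [abs_mul, abs_sgn, mul_one]
    rw [abs_of_nonneg (sub_nonneg.2 h1), abs_of_nonneg h0]
    linarith⟩

/-- The identifications of the quadrilaterals `Q(e)`, `e : E`, along their sides that are prescribed by
a map `next` on the set `E × Bool × Bool` of all these sides; `(e, s, t)` is the side of `Q(e)` from the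
auxiliary point on side `s` of `e` to the end point `t` of `e`. -/
def Glue {E : Type*} (next : E × Bool × Bool → E × Bool × Bool) (x y : E × Square) : Prop :=
  ∃ (a : E × Bool × Bool) (c : unitInterval),
    x = (a.1, leg a.2.1 a.2.2 c) ∧ y = ((next a).1, leg (next a).2.1 (next a).2.2 c)

/-- A (finite) cellular decomposition of the surface `S` with set of 1-cells `E` and set of 2-cells
`F`, together with auxiliary points in the 2-cells, joined to the vertices on their boundaries.
Every 1-cell `e` has two sides and two ends, both labelled by `Bool`; the 2-cell on side `s` of `e` is
`face e s` (both sides may belong to the same 2-cell).  The quadrilateral `Q(e)` is the image of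
`chart e`, and `S` is obtained from the quadrilaterals by identifying their sides in pairs. -/
structure CellDecomposition (S : Type*) [TopologicalSpace S] (E F : Type*) where
  /-- the 2-cell on the given side of a 1-cell -/
  face : E → Bool → F
  /-- the segment from an auxiliary point to a vertex, seen as a side of `Q(e)`, is also a side of the
  quadrilateral of the neighbouring 1-cell on the boundary of the same 2-cell -/
  next : E × Bool × Bool → E × Bool × Bool
  next_next : ∀ a, next (next a) = a
  next_ne : ∀ a, next a ≠ a
  face_surjective : ∀ f, ∃ e s, face e s = f
  /-- the sides of 1-cells on the boundary of one 2-cell are those met when going round it -/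
  face_eq_iff : ∀ e s e' s', face e s = face e' s' ↔
    Relation.EqvGen (fun x y : E × Bool => ∃ t t', next (x.1, x.2, t) = (y.1, y.2, t'))
      (e, s) (e', s')
  chart : E → Square → S
  continuous_chart : ∀ e, Continuous (chart e)
  chart_surjective : ∀ p, ∃ e x, chart e x = p
  chart_eq_iff : ∀ e x e' x', chart e x = chart e' x' ↔
    Relation.EqvGen (Glue next) (e, x) (e', x')

/-! ### Spherical bigons and quadrilaterals -/

/-- Spherical distance of the centres of two spherical disks of radii `r₁`, `r₂` which meet at the
angle `φ` (the interior angle of their intersection). -/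
def centerDist (φ r₁ r₂ : ℝ) : ℝ :=
  Real.arccos (Real.cos r₁ * Real.cos r₂ - Real.sin r₁ * Real.sin r₂ * Real.cos φ)

/-- Angle at the centre of the first disk between the centre of the second disk and an
intersection point of the two boundary circles (spherical law of cosines). -/
def halfAngle (φ r₁ r₂ : ℝ) : ℝ :=
  Real.arccos ((Real.cos r₂ - Real.cos r₁ * Real.cos (centerDist φ r₁ r₂)) /
    (Real.sin r₁ * Real.sin (centerDist φ r₁ r₂)))

/-- Length of the side of the bigon that lies on the boundary of the first disk: an arc with central
angle `2 * halfAngle` of a circle of spherical radius `r₁`. -/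
def sideLength (φ r₁ r₂ : ℝ) : ℝ := 2 * halfAngle φ r₁ r₂ * Real.sin r₁

/-- Total geodesic curvature of that side; the boundary circle has geodesic curvature `cot r₁`. -/
def sideCurvature (φ r₁ r₂ : ℝ) : ℝ := sideLength φ r₁ r₂ * Real.cot r₁

/-- Ambient space of the unit sphere. The spherical distance of unit vectors is their angle. -/
abbrev E3 : Type := EuclideanSpace ℝ (Fin 3)

/-- Centres of the first (`false`) and the second (`true`) disk, placed on the unit sphere. -/
def center (φ r₁ r₂ : ℝ) (s : Bool) : E3 :=
  cond s !₂[Real.cos (centerDist φ r₁ r₂), Real.sin (centerDist φ r₁ r₂), 0] !₂[1, 0, 0]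

/-- The two intersection points of the boundary circles of these disks. -/
def corner (φ r₁ r₂ : ℝ) (t : Bool) : E3 :=
  !₂[Real.cos r₁, Real.sin r₁ * Real.cos (halfAngle φ r₁ r₂),
    sgn t * (Real.sin r₁ * Real.sin (halfAngle φ r₁ r₂))]

/-- The (convex) spherical quadrilateral spanned by the two centres and the two intersection points. -/
def quad (φ r₁ r₂ : ℝ) : Set E3 :=
  {x | ‖x‖ = 1 ∧ ∃ a b c d : ℝ, 0 ≤ a ∧ 0 ≤ b ∧ 0 ≤ c ∧ 0 ≤ d ∧
    x = a • center φ r₁ r₂ false + b • center φ r₁ r₂ true +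
      c • corner φ r₁ r₂ false + d • corner φ r₁ r₂ true}

/-! ### Spherical conical metrics with circle patterns -/

/-- A spherical conical metric with circle pattern on `S` which realizes the weight `Φ`: radii in
`(0, π/2]` of the disks, and an identification of every `Q(e)` with the spherical quadrilateral of
two disks which have the radii of the 2-cells beside `e` and intersection angle `Φ e`, such that
these identifications agree isometrically on the common sides of the quadrilaterals. -/
structure ConicalMetric {S : Type*} [TopologicalSpace S] {E F : Type*}
    (D : CellDecomposition S E F) (Φ : E → ℝ) where
  radius : F → ℝ
  radius_pos : ∀ f, 0 < radius f
  radius_le : ∀ f, radius f ≤ Real.pi / 2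
  coord : ∀ e, Square ≃ₜ quad (Φ e) (radius (D.face e false)) (radius (D.face e true))
  coord_center : ∀ e s t, (coord e (leg s t 0) : E3) =
    center (Φ e) (radius (D.face e false)) (radius (D.face e true)) s
  coord_corner : ∀ e s t, (coord e (leg s t 1) : E3) =
    corner (Φ e) (radius (D.face e false)) (radius (D.face e true)) t
  /-- sides are mapped to geodesic segments -/
  coord_leg : ∀ e s t c,
    InnerProductGeometry.angle (coord e (leg s t 0) : E3) (coord e (leg s t c)) +
      InnerProductGeometry.angle (coord e (leg s t c) : E3) (coord e (leg s t 1)) =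
    InnerProductGeometry.angle (coord e (leg s t 0) : E3) (coord e (leg s t 1))
  /-- identified sides are identified isometrically -/
  coord_glue : ∀ e s t e' s' t' c, D.next (e, s, t) = (e', s', t') →
    InnerProductGeometry.angle (coord e (leg s t 0) : E3) (coord e (leg s t c)) =
    InnerProductGeometry.angle (coord e' (leg s' t' 0) : E3) (coord e' (leg s' t' c))

namespace ConicalMetric

variable {S : Type*} [TopologicalSpace S] {E F : Type*} {D : CellDecomposition S E F} {Φ : E → ℝ}

/-- Distance of two points inside a common spherical quadrilateral (`⊤` if there is none). -/
def localDist (M : ConicalMetric D Φ) (p q : S) : ℝ≥0∞ :=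
  ⨅ (e : E) (x : Square) (y : Square) (_ : D.chart e x = p ∧ D.chart e y = q),
    ENNReal.ofReal (InnerProductGeometry.angle (M.coord e x : E3) (M.coord e y))

/-- The distance function on `S` obtained by gluing the spherical quadrilaterals: infimum of the
lengths of chains of points (`⊤` for points in different components). -/
def dist (M : ConicalMetric D Φ) (p q : S) : ℝ≥0∞ :=
  ⨅ (n : ℕ) (z : Fin (n + 1) → S) (_ : z 0 = p ∧ z (Fin.last n) = q),
    ∑ i : Fin n, M.localDist (z i.castSucc) (z i.succ)

/-- The immersed disk of the circle pattern that belongs to the 2-cell `f` (its image in `S`). -/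
def disk (M : ConicalMetric D Φ) (f : F) : Set S :=
  {p | ∃ e s x, D.face e s = f ∧ D.chart e x = p ∧
    InnerProductGeometry.angle
      (center (Φ e) (M.radius (D.face e false)) (M.radius (D.face e true)) s)
      (M.coord e x : E3) < M.radius f}

/-- A degenerated circle pattern metric: some radius is `π/2`. -/
def IsDegenerated (M : ConicalMetric D Φ) : Prop := ∃ f, M.radius f = Real.pi / 2

open Classical in
/-- Total geodesic curvature of the 2-cell `f`: the sum over all sides of 1-cells on the boundary of
`f` (a 1-cell with `f` on both sides contributes both sides of its bigon). -/
def totalCurvature [Fintype E] (M : ConicalMetric D Φ) (f : F) : ℝ :=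
  ∑ e : E, ∑ s : Bool, if D.face e s = f then
    sideCurvature (Φ e) (M.radius (D.face e s)) (M.radius (D.face e (!s))) else 0

/-- The metrics agree up to isometry: corresponding disks have equal radii, and there is an isometry
of `S` which carries one circle pattern to the other, and which respects the decomposition (it maps
each quadrilateral to itself and fixes the vertices and the auxiliary points). -/
def IsIsometric (M M' : ConicalMetric D Φ) : Prop :=
  M.radius = M'.radius ∧
  ∃ ψ : S ≃ₜ S,
    (∀ p q, M'.dist (ψ p) (ψ q) = M.dist p q) ∧
    (∀ f, ψ '' M.disk f = M'.disk f) ∧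
    (∀ e, ψ '' Set.range (D.chart e) = Set.range (D.chart e)) ∧
    (∀ e s t, ψ (D.chart e (leg s t 0)) = D.chart e (leg s t 0)) ∧
    (∀ e s t, ψ (D.chart e (leg s t 1)) = D.chart e (leg s t 1))

end ConicalMetric

/-! ### Admissible total geodesic curvatures -/

open Classical in
/-- The set `E_{F'}` of the 1-cells on the boundary of some 2-cell in `F'`. -/
def edgesOf {S : Type*} [TopologicalSpace S] {E F : Type*} [Fintype E]
    (D : CellDecomposition S E F) (F' : Finset F) : Finset E :=
  Finset.univ.filter fun e => ∃ s, D.face e s ∈ F'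

/-- The set `𝓛_I`: vectors supported exactly on `I`, positive there, with the strict inequalities for
all nonempty subsets of `I`. -/
def curvatureSet {S : Type*} [TopologicalSpace S] {E F : Type*} [Fintype E]
    (D : CellDecomposition S E F) (Φ : E → ℝ) (I : Finset F) : Set (F → ℝ) :=
  {L | (∀ f, f ∉ I → L f = 0) ∧ (∀ f ∈ I, 0 < L f) ∧
    ∀ F' : Finset F, F' ⊆ I → F'.Nonempty →
      ∑ f ∈ F', L f < 2 * ∑ e ∈ edgesOf D F', Φ e}

/-- The union of `{0}` and the sets `𝓛_I` for the nonempty proper subsets `I` of the set of 2-cells. -/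
def degeneratedCurvatureSet {S : Type*} [TopologicalSpace S] {E F : Type*} [Fintype E] [Fintype F]
    (D : CellDecomposition S E F) (Φ : E → ℝ) : Set (F → ℝ) :=
  (⋃ (I : Finset F) (_ : I.Nonempty ∧ I ≠ Finset.univ), curvatureSet D Φ I) ∪ {0}

end SphericalPattern

end

noncomputable section

namespace SphericalPattern

open Filter Topology

/-! ### The total geodesic curvature of a bigon side as a function of geodesic curvatures -/

/-! In terms of the geodesic curvatures k_f = cot r_f ≥ 0, the total geodesic curvatures form an
explicit map K (`curvatureMap`), and the theorem reduces to two facts: K is injective on [0, ∞)^F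
with the right image, and the radii determine the metric up to isometry.

Two monotonicity properties of a single bigon drive the first fact. The curvature of a side
decreases when the curvature of the opposite circle grows (`sideTotal_antitone`). The curvature of
the whole bigon boundary strictly increases in both arguments (`bigonTotal_strictMono_left`) and
stays below its limit 2Φ(e) (`bigonTotal_lt`). Call k ≥ 0 a subsolution for L if K(k) ≤ L in every
coordinate. By the first property subsolutions are closed under suprema (`curvatureMap_sup_le`); by
the second, the sum of all coordinates of K is strictly increasing.

Uniqueness: if K(k) = K(k') = L, then k ⊔ k' is a subsolution above both, and comparing sums forces
k = k ⊔ k' = k'. Existence is a Perron argument: the inequalities on L bound the subsolutions,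
because the coordinates that are unbounded could be made large simultaneously, and their curvatures
would sum in the limit to at least 2 ∑ Φ(e) over the adjacent 1-cells. A subsolution with maximal
coordinate sum exists by compactness and solves K(k) = L, since a coordinate with slack could be
raised. Finally K_f(k) = 0 exactly when k_f = 0, so a hemisphere (r_f = π/2) corresponds to a
vanishing coordinate of L.

For the metrics, a spherical quadrilateral is the union of two triangles along the segment joining
the centres, and normalized barycentric coordinates on the cones over them parametrize it compatibly
with the gluing. Two metrics with equal radii use the same quadrilaterals. Comparing their
coordinates gives a self-map of each model square; it respects the gluing because a point on a side
is determined by its distance from the centre, and so it descends to the required isometry. -/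

/-- Cotangent of the half central angle, in terms of the geodesic curvatures of the two circles. -/
def cotHalf (φ a b : ℝ) : ℝ := (b + a * Real.cos φ) / (Real.sin φ * √(1 + a ^ 2))

/-- Half central angle of the bigon side on the circle of geodesic curvature `a`. -/
def theta (φ a b : ℝ) : ℝ := Real.pi / 2 - Real.arctan (cotHalf φ a b)

/-- Total geodesic curvature of the bigon side on the circle of geodesic curvature `a`. -/
def sideTotal (φ a b : ℝ) : ℝ := 2 * theta φ a b * (a / √(1 + a ^ 2))

/-- Total geodesic curvature of the whole boundary of the bigon. -/
def bigonTotal (φ a b : ℝ) : ℝ := sideTotal φ a b + sideTotal φ b a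

theorem bigonTotal_comm (φ a b : ℝ) : bigonTotal φ a b = bigonTotal φ b a := add_comm _ _

theorem sqrt_one_add_sq_pos (a : ℝ) : 0 < √(1 + a ^ 2) := Real.sqrt_pos.2 (by positivity)

theorem theta_pos (φ a b : ℝ) : 0 < theta φ a b := by
  have := Real.arctan_lt_pi_div_two (cotHalf φ a b)
  unfold theta; linarith

theorem sideTotal_zero (φ b : ℝ) : sideTotal φ 0 b = 0 := by simp [sideTotal]

theorem sideTotal_pos {φ a : ℝ} (ha : 0 < a) (b : ℝ) : 0 < sideTotal φ a b := by
  have := theta_pos φ a b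
  have := sqrt_one_add_sq_pos a
  unfold sideTotal; positivity

theorem sideTotal_nonneg {φ a : ℝ} (ha : 0 ≤ a) (b : ℝ) : 0 ≤ sideTotal φ a b := by
  have := theta_pos φ a b
  unfold sideTotal; positivity

section

variable {φ : ℝ} (hφ : 0 < Real.sin φ)
include hφ

theorem continuous_sideTotal : Continuous fun p : ℝ × ℝ => sideTotal φ p.1 p.2 := by
  unfold sideTotal theta cotHalf
  have h : ∀ p : ℝ × ℝ, √(1 + p.1 ^ 2) ≠ 0 := fun p => (sqrt_one_add_sq_pos _).ne'
  have h' : ∀ p : ℝ × ℝ, Real.sin φ * √(1 + p.1 ^ 2) ≠ 0 := fun p => mul_ne_zero hφ.ne' (h p)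
  fun_prop (disch := assumption)

/-- Shrinking the opposite circle enlarges the cotangent of the half angle, so the arc it cuts out
becomes narrower. -/
theorem sideTotal_antitone {a b b' : ℝ} (ha : 0 ≤ a) (hb : b ≤ b') :
    sideTotal φ a b' ≤ sideTotal φ a b := by
  have hs := sqrt_one_add_sq_pos a
  have h : cotHalf φ a b ≤ cotHalf φ a b' := by unfold cotHalf; gcongr
  have h2 := Real.arctan_mono h
  unfold sideTotal theta
  gcongr

/-! ### Derivatives and monotonicity of the bigon curvature -/

/-- The expression equals sin² φ (1 + a²) + (b + a cos φ)². Being symmetric in a and b, it is a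
common denominator for the derivatives of both half angles. -/
theorem discriminant_pos (a b : ℝ) :
    0 < Real.sin φ ^ 2 + a ^ 2 + b ^ 2 + 2 * a * b * Real.cos φ := by
  nlinarith [sq_nonneg (a * Real.cos φ + b), Real.sin_sq_add_cos_sq φ,
    mul_nonneg (sq_nonneg a) (sq_nonneg (Real.sin φ)), sq_pos_of_pos hφ]

theorem hasDerivAt_theta_left (a b : ℝ) :
    HasDerivAt (fun x => theta φ x b)
      (-((Real.cos φ - a * b) * Real.sin φ /
        (√(1 + a ^ 2) * (Real.sin φ ^ 2 + a ^ 2 + b ^ 2 + 2 * a * b * Real.cos φ)))) a := by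
  have hs := sqrt_one_add_sq_pos a
  have hs2 : √(1 + a ^ 2) ^ 2 = 1 + a ^ 2 := Real.sq_sqrt (by positivity)
  have hD := discriminant_pos hφ a b
  have h1 : HasDerivAt (fun x : ℝ => √(1 + x ^ 2)) (2 * a / (2 * √(1 + a ^ 2))) a := by
    have : HasDerivAt (fun x : ℝ => 1 + x ^ 2) (2 * a) a := by
      simpa using (hasDerivAt_pow 2 a).const_add 1
    exact this.sqrt (by positivity)
  have h2 : HasDerivAt (fun x : ℝ => b + x * Real.cos φ) (Real.cos φ) a := by
    simpa using ((hasDerivAt_id a).mul_const (Real.cos φ)).const_add b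
  have h3 := (h2.div (h1.const_mul (Real.sin φ)) (by positivity)).arctan.const_sub (Real.pi / 2)
  refine h3.congr_deriv ?_
  rw [neg_inj]
  have key : 1 + ((b + a * Real.cos φ) / (Real.sin φ * √(1 + a ^ 2))) ^ 2 =
      (Real.sin φ ^ 2 + a ^ 2 + b ^ 2 + 2 * a * b * Real.cos φ) /
        (Real.sin φ ^ 2 * (1 + a ^ 2)) := by
    rw [div_pow, mul_pow, hs2]
    field_simp
    linear_combination a ^ 2 * Real.sin_sq_add_cos_sq φ
  simp only [Pi.div_apply]
  rw [key]
  have h1a : (0:ℝ) < 1 + a ^ 2 := by positivity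
  generalize Real.sin φ ^ 2 + a ^ 2 + b ^ 2 + 2 * a * b * Real.cos φ = D at *
  clear h3 h1 key h1a
  generalize √(1 + a ^ 2) = s at hs hs2 ⊢
  rw [← hs2]
  field_simp
  linear_combination Real.cos φ * hs2

/-- The variable is the second argument, still called a, so that this formula adds directly to
`hasDerivAt_theta_left` in the derivative of the bigon total. -/
theorem hasDerivAt_theta_right (a b : ℝ) :
    HasDerivAt (fun x => theta φ b x)
      (-(√(1 + b ^ 2) * Real.sin φ /
        (Real.sin φ ^ 2 + a ^ 2 + b ^ 2 + 2 * a * b * Real.cos φ))) a := by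
  have hs := sqrt_one_add_sq_pos b
  have hs2 : √(1 + b ^ 2) ^ 2 = 1 + b ^ 2 := Real.sq_sqrt (by positivity)
  have hD := discriminant_pos hφ a b
  have h2 : HasDerivAt (fun x : ℝ => x + b * Real.cos φ) 1 a := (hasDerivAt_id a).add_const _
  have h3 := (h2.div_const (Real.sin φ * √(1 + b ^ 2))).arctan.const_sub (Real.pi / 2)
  refine h3.congr_deriv ?_
  rw [neg_inj]
  have key : 1 + ((a + b * Real.cos φ) / (Real.sin φ * √(1 + b ^ 2))) ^ 2 =
      (Real.sin φ ^ 2 + a ^ 2 + b ^ 2 + 2 * a * b * Real.cos φ) /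
        (Real.sin φ ^ 2 * (1 + b ^ 2)) := by
    rw [div_pow, mul_pow, hs2]
    field_simp
    linear_combination b ^ 2 * Real.sin_sq_add_cos_sq φ
  rw [key]
  generalize Real.sin φ ^ 2 + a ^ 2 + b ^ 2 + 2 * a * b * Real.cos φ = D at *
  clear h3 key
  generalize √(1 + b ^ 2) = s at hs hs2 ⊢
  rw [← hs2]
  field_simp

/-- The derivative of the total curvature of the bigon boundary with respect to one of the curvatures
is `2 (θ - sin θ cos θ) / √(1 + a²)³`. -/
theorem hasDerivAt_bigonTotal (a b : ℝ) :
    HasDerivAt (fun x => bigonTotal φ x b)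
      (2 * (theta φ a b - Real.sin (theta φ a b) * Real.cos (theta φ a b)) /
        √(1 + a ^ 2) ^ 3) a := by
  have hs := sqrt_one_add_sq_pos a
  have hs2 : √(1 + a ^ 2) ^ 2 = 1 + a ^ 2 := Real.sq_sqrt (by positivity)
  have hD := discriminant_pos hφ a b
  have h1 : HasDerivAt (fun x : ℝ => √(1 + x ^ 2)) (2 * a / (2 * √(1 + a ^ 2))) a := by
    have : HasDerivAt (fun x : ℝ => 1 + x ^ 2) (2 * a) a := by
      simpa using (hasDerivAt_pow 2 a).const_add 1
    exact this.sqrt (by positivity)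
  have h2 : HasDerivAt (fun x : ℝ => x / √(1 + x ^ 2)) (1 / √(1 + a ^ 2) ^ 3) a := by
    refine ((hasDerivAt_id a).div h1 hs.ne').congr_deriv ?_
    simp only [id]
    field_simp
    rw [hs2]; ring
  have h3 := (((hasDerivAt_theta_left hφ a b).const_mul 2).mul h2).add
    (((hasDerivAt_theta_right hφ a b).const_mul 2).mul_const (b / √(1 + b ^ 2)))
  refine h3.congr_deriv ?_
  -- For cot θ = u, one has sin θ cos θ = u / (1 + u²). This is the rational part left over when the
  -- derivatives of both half angles are combined.
  have hsc : Real.sin (theta φ a b) * Real.cos (theta φ a b) =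
      cotHalf φ a b / (1 + cotHalf φ a b ^ 2) := by
    unfold theta
    rw [Real.sin_pi_div_two_sub, Real.cos_pi_div_two_sub, Real.sin_arctan, Real.cos_arctan]
    rw [div_mul_div_comm, one_mul, Real.mul_self_sqrt (by positivity)]
  have key : 1 + cotHalf φ a b ^ 2 =
      (Real.sin φ ^ 2 + a ^ 2 + b ^ 2 + 2 * a * b * Real.cos φ) /
        (Real.sin φ ^ 2 * √(1 + a ^ 2) ^ 2) := by
    unfold cotHalf
    rw [div_pow, mul_pow, hs2]
    field_simp
    linear_combination a ^ 2 * Real.sin_sq_add_cos_sq φ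
  rw [hsc, key]
  unfold cotHalf
  have hb := sqrt_one_add_sq_pos b
  clear h3 h2 h1 hsc key
  generalize theta φ a b = t
  generalize √(1 + a ^ 2) = s at hs hs2 ⊢
  generalize √(1 + b ^ 2) = s' at hb ⊢
  generalize Real.sin φ ^ 2 + a ^ 2 + b ^ 2 + 2 * a * b * Real.cos φ = D at *
  field_simp
  linear_combination (-(b * Real.sin φ * s)) * hs2

theorem bigonTotal_strictMono_left (b : ℝ) : StrictMono fun a => bigonTotal φ a b := by
  refine strictMono_of_deriv_pos fun a => ?_
  rw [(hasDerivAt_bigonTotal hφ a b).deriv]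
  have ht := theta_pos φ a b
  -- The sign of the derivative comes from sin 2θ < 2θ.
  have h := Real.sin_lt (x := 2 * theta φ a b) (by positivity)
  rw [Real.sin_two_mul] at h
  have := sqrt_one_add_sq_pos a
  have : 0 < theta φ a b - Real.sin (theta φ a b) * Real.cos (theta φ a b) := by linarith
  positivity

theorem bigonTotal_le {a a' b b' : ℝ} (ha : a ≤ a') (hb : b ≤ b') :
    bigonTotal φ a b ≤ bigonTotal φ a' b' := by
  refine ((bigonTotal_strictMono_left hφ b).monotone ha).trans ?_
  simp only [bigonTotal_comm φ a']
  exact (bigonTotal_strictMono_left hφ a').monotone hb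

theorem bigonTotal_lt_left {a a' b b' : ℝ} (ha : a < a') (hb : b ≤ b') :
    bigonTotal φ a b < bigonTotal φ a' b' :=
  ((bigonTotal_strictMono_left hφ b) ha).trans_le (bigonTotal_le hφ le_rfl hb)

/-- The bigon total grows with a while the opposite side shrinks, so the side on the circle of
curvature a must grow. The sign of b is needed for the opposite side only. -/
theorem sideTotal_mono {a a' b : ℝ} (ha : a ≤ a') (hb : 0 ≤ b) :
    sideTotal φ a b ≤ sideTotal φ a' b := by
  have h1 := bigonTotal_le hφ ha (le_refl b)
  have h2 := sideTotal_antitone hφ hb ha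
  unfold bigonTotal at h1
  linarith

end

/-! ### Limits for large geodesic curvature -/

theorem pi_div_two_sub_arctan_cot {x : ℝ} (hx0 : 0 < x) (hx1 : x < Real.pi / 2) :
    Real.pi / 2 - Real.arctan (Real.cos x / Real.sin x) = x := by
  have : Real.cos x / Real.sin x = Real.tan (Real.pi / 2 - x) := by
    rw [Real.tan_eq_sin_div_cos, Real.sin_pi_div_two_sub, Real.cos_pi_div_two_sub]
  rw [this, Real.arctan_tan (by linarith) (by linarith)]
  ring

theorem tendsto_div_sqrt_one_add_sq :
    Tendsto (fun x : ℝ => x / √(1 + x ^ 2)) atTop (𝓝 1) := by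
  have h : Tendsto (fun x : ℝ => √(1 + x ^ 2) / x) atTop (𝓝 1) := by
    have h1 : Tendsto (fun x : ℝ => √((x ^ 2)⁻¹ + 1)) atTop (𝓝 1) := by
      have := ((tendsto_pow_atTop (α := ℝ) two_ne_zero).inv_tendsto_atTop.add_const 1).sqrt
      simpa using this
    refine h1.congr' ?_
    filter_upwards [eventually_gt_atTop 0] with x hx
    rw [eq_div_iff hx.ne']
    nth_rw 2 [← Real.sqrt_sq hx.le]
    rw [← Real.sqrt_mul (by positivity)]
    congr 1
    field_simp
  simpa using h.inv₀ one_ne_zero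

theorem tendsto_inv_sqrt_one_add_sq :
    Tendsto (fun x : ℝ => 1 / √(1 + x ^ 2)) atTop (𝓝 0) := by
  have h := tendsto_div_sqrt_one_add_sq.mul tendsto_inv_atTop_zero
  rw [mul_zero] at h
  refine h.congr' ?_
  filter_upwards [eventually_gt_atTop 0] with x hx
  field_simp

section

variable {φ : ℝ} (h0 : 0 < φ) (h1 : φ < Real.pi / 2)
include h0 h1

/-- When one circle shrinks to a point and the other is fixed, the half angle at the shrinking
circle tends to φ. -/
theorem tendsto_sideTotal (b : ℝ) :
    Tendsto (fun a => sideTotal φ a b) atTop (𝓝 (2 * φ)) := by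
  have hs : 0 < Real.sin φ := Real.sin_pos_of_pos_of_lt_pi h0 (by linarith)
  have hc : Tendsto (fun a => cotHalf φ a b) atTop (𝓝 (Real.cos φ / Real.sin φ)) := by
    have := ((tendsto_inv_sqrt_one_add_sq.const_mul b).add
      (tendsto_div_sqrt_one_add_sq.mul_const (Real.cos φ))).div_const (Real.sin φ)
    simp only [mul_zero, zero_add, one_mul] at this
    refine this.congr fun a => ?_
    have := sqrt_one_add_sq_pos a
    unfold cotHalf; field_simp
  have ht := (Real.continuous_arctan.tendsto _).comp hc |>.const_sub (Real.pi / 2)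
  rw [pi_div_two_sub_arctan_cot h0 h1] at ht
  simpa [sideTotal, theta] using (ht.const_mul 2).mul tendsto_div_sqrt_one_add_sq

/-- When both circles shrink at the same rate, each half angle tends to φ / 2, because (1 + cos φ) /
sin φ = cot (φ / 2); each side then contributes φ. -/
theorem tendsto_bigonTotal_diag :
    Tendsto (fun a => bigonTotal φ a a) atTop (𝓝 (2 * φ)) := by
  have hs : 0 < Real.sin φ := Real.sin_pos_of_pos_of_lt_pi h0 (by linarith)
  have hs' : 0 < Real.sin (φ / 2) := Real.sin_pos_of_pos_of_lt_pi (by linarith) (by linarith)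
  have hc' : 0 < Real.cos (φ / 2) := Real.cos_pos_of_mem_Ioo ⟨by linarith, by linarith⟩
  have hc : Tendsto (fun a => cotHalf φ a a) atTop (𝓝 (Real.cos (φ / 2) / Real.sin (φ / 2))) := by
    have e : Real.cos (φ / 2) / Real.sin (φ / 2) = (1 + Real.cos φ) / Real.sin φ := by
      have hφ : φ = 2 * (φ / 2) := by ring
      rw [hφ, Real.cos_two_mul, Real.sin_two_mul, ← hφ]
      field_simp
      ring
    rw [e]
    have := (tendsto_div_sqrt_one_add_sq.mul_const (1 + Real.cos φ)).div_const (Real.sin φ)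
    rw [one_mul] at this
    refine this.congr fun a => ?_
    have := sqrt_one_add_sq_pos a
    unfold cotHalf; field_simp
  have ht := (Real.continuous_arctan.tendsto _).comp hc |>.const_sub (Real.pi / 2)
  rw [pi_div_two_sub_arctan_cot (by linarith) (by linarith)] at ht
  have := ((ht.const_mul 2).mul tendsto_div_sqrt_one_add_sq).const_mul 2
  have e : 2 * (2 * (φ / 2) * 1) = 2 * φ := by ring
  rw [e] at this
  refine this.congr fun a => ?_
  simp only [bigonTotal, sideTotal, theta, Function.comp]
  ring

theorem bigonTotal_lt (a b : ℝ) : bigonTotal φ a b < 2 * φ := by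
  have hs : 0 < Real.sin φ := Real.sin_pos_of_pos_of_lt_pi h0 (by linarith)
  -- Any point lies strictly below a diagonal point, and the diagonal values increase to 2φ; the
  -- summand 1 makes the first comparison strict.
  refine (bigonTotal_lt_left hs (a' := max a b + 1) (b' := max a b + 1) ?_ ?_).trans_le ?_
  · linarith [le_max_left a b]
  · linarith [le_max_right a b]
  · exact Monotone.ge_of_tendsto (f := fun a => bigonTotal φ a a)
      (fun x y h => bigonTotal_le hs h h) (tendsto_bigonTotal_diag h0 h1) _

end

end SphericalPattern

end

noncomputable section

namespace SphericalPattern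

open Filter Topology

/-! ### The curvature map and its inversion -/

section

variable {E F : Type*} [Fintype E] (face : E → Bool → F) (Φ : E → ℝ)

open Classical in
/-- Total geodesic curvatures in terms of the geodesic curvatures `k` of the circles. -/
def curvatureMap (k : F → ℝ) (f : F) : ℝ :=
  ∑ e : E, ∑ s : Bool, if face e s = f then
    sideTotal (Φ e) (k (face e s)) (k (face e (!s))) else 0

open Classical in
/-- The 1-cells with a side in `F'`. -/
def edgesWith (F' : Finset F) : Finset E :=
  Finset.univ.filter fun e => ∃ s, face e s ∈ F'

variable {face Φ}

open Classical in
-- Regrouping by 1-cells allows the estimates for single bigons to be summed.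
theorem sum_curvatureMap (k : F → ℝ) (F' : Finset F) :
    ∑ f ∈ F', curvatureMap face Φ k f = ∑ e ∈ edgesWith face F', ∑ s : Bool,
      if face e s ∈ F' then sideTotal (Φ e) (k (face e s)) (k (face e (!s))) else 0 := by
  unfold curvatureMap edgesWith
  rw [Finset.sum_comm, Finset.sum_filter]
  refine Finset.sum_congr rfl fun e _ => ?_
  rw [Finset.sum_comm]
  split_ifs with h
  · refine Finset.sum_congr rfl fun s _ => ?_
    simp
  · push Not at h
    simp [h]

theorem sum_curvatureMap_univ [Fintype F] (k : F → ℝ) :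
    ∑ f, curvatureMap face Φ k f =
      ∑ e, bigonTotal (Φ e) (k (face e false)) (k (face e true)) := by
  classical
  rw [sum_curvatureMap]
  simp [edgesWith, bigonTotal, add_comm]

theorem curvatureMap_eq_zero {k : F → ℝ} {f : F} (h : k f = 0) :
    curvatureMap face Φ k f = 0 := by
  classical
  refine Finset.sum_eq_zero fun e _ => Finset.sum_eq_zero fun s _ => ?_
  split_ifs with h'
  · rw [h', h, sideTotal_zero]
  · rfl

theorem curvatureMap_pos (hface : ∀ f, ∃ e s, face e s = f) {k : F → ℝ} (hk : ∀ f, 0 ≤ k f)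
    {f : F} (hf : 0 < k f) : 0 < curvatureMap face Φ k f := by
  classical
  obtain ⟨e, s, rfl⟩ := hface f
  have h0 : ∀ e' s', 0 ≤ if face e' s' = face e s then
      sideTotal (Φ e') (k (face e' s')) (k (face e' (!s'))) else 0 := by
    intro e' s'
    split_ifs
    · exact sideTotal_nonneg (hk _) _
    · exact le_rfl
  refine Finset.sum_pos' (fun e' _ => Finset.sum_nonneg fun s' _ => h0 e' s')
    ⟨e, Finset.mem_univ _, Finset.sum_pos' (fun s' _ => h0 e s') ⟨s, Finset.mem_univ _, ?_⟩⟩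
  rw [if_pos rfl]
  exact sideTotal_pos hf _

theorem edgesWith_nonempty (hface : ∀ f, ∃ e s, face e s = f) {F' : Finset F}
    (h : F'.Nonempty) : (edgesWith face F').Nonempty := by
  classical
  obtain ⟨f, hf⟩ := h
  obtain ⟨e, s, rfl⟩ := hface f
  exact ⟨e, by simpa [edgesWith] using (⟨s, hf⟩ : ∃ s, face e s ∈ F')⟩

variable (hΦ : ∀ e, 0 < Φ e ∧ Φ e < Real.pi / 2)
include hΦ

omit [Fintype E] in
theorem sin_weight_pos (e : E) : 0 < Real.sin (Φ e) :=
  Real.sin_pos_of_pos_of_lt_pi (hΦ e).1 (by linarith [(hΦ e).2, Real.pi_pos])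

theorem continuous_curvatureMap (f : F) : Continuous fun k => curvatureMap face Φ k f := by
  classical
  have hc : ∀ e s, Continuous fun k : F → ℝ =>
      if face e s = f then sideTotal (Φ e) (k (face e s)) (k (face e (!s))) else 0 := by
    intro e s
    have h : Continuous fun k : F → ℝ => (k (face e s), k (face e (!s))) := by fun_prop
    have h' := (continuous_sideTotal (sin_weight_pos hΦ e)).comp h
    by_cases hf : face e s = f
    · simpa only [hf, if_true, Function.comp_def] using h'
    · simpa only [hf, if_false] using continuous_const
  exact continuous_finsetSum _ fun e _ => continuous_finsetSum _ fun s _ => hc e s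

/-- A 1-cell next to F' contributes one or both sides of its bigon, hence at most the bigon total,
which is less than 2Φ(e). This is the necessity of the inequalities. -/
theorem sum_curvatureMap_lt (hface : ∀ f, ∃ e s, face e s = f) {k : F → ℝ} (hk : ∀ f, 0 ≤ k f)
    {F' : Finset F} (h : F'.Nonempty) :
    ∑ f ∈ F', curvatureMap face Φ k f < 2 * ∑ e ∈ edgesWith face F', Φ e := by
  classical
  rw [sum_curvatureMap, Finset.mul_sum]
  refine Finset.sum_lt_sum_of_nonempty (edgesWith_nonempty hface h) fun e _ => ?_
  refine lt_of_le_of_lt ?_ (bigonTotal_lt (hΦ e).1 (hΦ e).2 (k (face e true)) (k (face e false)))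
  rw [Fintype.sum_bool]
  have h1 := sideTotal_nonneg (φ := Φ e) (hk (face e true)) (k (face e false))
  have h2 := sideTotal_nonneg (φ := Φ e) (hk (face e false)) (k (face e true))
  simp only [Bool.not_true, Bool.not_false, bigonTotal]
  split_ifs <;> linarith

/-! ### Monotonicity, subsolutions and uniqueness -/

/-- The curvature of a 2-cell decreases when the other circles shrink. -/
theorem curvatureMap_le_of_le {k k' : F → ℝ} (hk : ∀ f, 0 ≤ k f) (hle : k ≤ k') {f : F}
    (hf : k f = k' f) : curvatureMap face Φ k' f ≤ curvatureMap face Φ k f := by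
  classical
  refine Finset.sum_le_sum fun e _ => Finset.sum_le_sum fun s _ => ?_
  split_ifs with h
  · rw [h, ← hf]
    exact sideTotal_antitone (sin_weight_pos hΦ e) (hk f) (hle _)
  · exact le_rfl

/-- Summed over all 2-cells, the curvatures become a sum of bigon totals, and any coordinate that
increases occurs in at least one of them. -/
theorem sum_curvatureMap_strict [Fintype F] (hface : ∀ f, ∃ e s, face e s = f) {k k' : F → ℝ}
    (hle : k ≤ k') (h : ∑ f, curvatureMap face Φ k' f ≤ ∑ f, curvatureMap face Φ k f) :
    k = k' := by
  rw [sum_curvatureMap_univ, sum_curvatureMap_univ] at h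
  by_contra hne
  obtain ⟨f, hf⟩ : ∃ f, k f < k' f := by
    by_contra! hh
    exact hne (le_antisymm hle hh)
  refine h.not_gt (Finset.sum_lt_sum
    (fun e _ => bigonTotal_le (sin_weight_pos hΦ e) (hle _) (hle _)) ?_)
  obtain ⟨e, s, rfl⟩ := hface f
  refine ⟨e, Finset.mem_univ _, ?_⟩
  cases s
  · exact bigonTotal_lt_left (sin_weight_pos hΦ e) hf (hle _)
  · rw [bigonTotal_comm, bigonTotal_comm _ (k' _)]
    exact bigonTotal_lt_left (sin_weight_pos hΦ e) hf (hle _)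

/-- At each f the supremum agrees with one of the two vectors, and all other coordinates can only
have grown, which lowers the curvature at f. -/
theorem curvatureMap_sup_le {k k' L : F → ℝ} (hk : ∀ f, 0 ≤ k f) (hk' : ∀ f, 0 ≤ k' f)
    (h : ∀ f, curvatureMap face Φ k f ≤ L f) (h' : ∀ f, curvatureMap face Φ k' f ≤ L f) (f : F) :
    curvatureMap face Φ (k ⊔ k') f ≤ L f := by
  rcases le_total (k f) (k' f) with hf | hf
  · exact (curvatureMap_le_of_le hΦ hk' le_sup_right (by simp [hf])).trans (h' f)
  · exact (curvatureMap_le_of_le hΦ hk le_sup_left (by simp [hf])).trans (h f)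

/-- The supremum of two solutions is a subsolution above both, so strict monotonicity of the total
identifies it with each of them. -/
theorem curvatureMap_injOn [Fintype F] (hface : ∀ f, ∃ e s, face e s = f) {k k' : F → ℝ}
    (hk : ∀ f, 0 ≤ k f) (hk' : ∀ f, 0 ≤ k' f)
    (h : ∀ f, curvatureMap face Φ k f = curvatureMap face Φ k' f) : k = k' := by
  have hs := curvatureMap_sup_le hΦ hk hk' (fun f => (h f).le) (fun f => le_rfl)
  have h1 : k = k ⊔ k' := sum_curvatureMap_strict hΦ hface le_sup_left
    (Finset.sum_le_sum fun f _ => (hs f).trans (h f).ge)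
  have h2 : k' = k ⊔ k' := sum_curvatureMap_strict hΦ hface le_sup_right
    (Finset.sum_le_sum fun f _ => hs f)
  rw [h1, ← h2]

/-! ### Existence by maximal subsolutions -/

/-- Nonnegative vectors whose curvatures are at most `L` are bounded. -/
theorem exists_bound_of_curvatureMap_le [Fintype F] {L : F → ℝ}
    (hL : ∀ F' : Finset F, F'.Nonempty → ∑ f ∈ F', L f < 2 * ∑ e ∈ edgesWith face F', Φ e) :
    ∃ B : ℝ, ∀ k : F → ℝ, (∀ f, 0 ≤ k f) → (∀ f, curvatureMap face Φ k f ≤ L f) →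
      ∀ f, k f ≤ B := by
  classical
  let A : Set (F → ℝ) := {k | (∀ f, 0 ≤ k f) ∧ ∀ f, curvatureMap face Φ k f ≤ L f}
  -- U collects the coordinates that are unbounded on the set A of subsolutions; the others share
  -- one bound B.
  let U : Finset F := Finset.univ.filter fun f => ¬ ∃ B : ℝ, ∀ k ∈ A, k f ≤ B
  have hU : ∀ f, f ∉ U → ∃ B : ℝ, ∀ k ∈ A, k f ≤ B := by
    intro f hf
    by_contra h
    exact hf (Finset.mem_filter.2 ⟨Finset.mem_univ _, h⟩)
  have hB : ∃ B : ℝ, ∀ f, f ∉ U → ∀ k ∈ A, k f ≤ B := by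
    choose! B hB using hU
    refine ⟨∑ f, |B f|, fun f hf k hk => (hB f hf k hk).trans ((le_abs_self _).trans ?_)⟩
    exact Finset.single_le_sum (f := fun f => |B f|) (fun _ _ => abs_nonneg _) (Finset.mem_univ f)
  obtain ⟨B, hB⟩ := hB
  rcases U.eq_empty_or_nonempty with hUe | hUn
  · exact ⟨B, fun k hk hk' f => hB f (by simp [hUe]) k ⟨hk, hk'⟩⟩
  exfalso
  have hA : A.Nonempty := by
    obtain ⟨f, hf⟩ := hUn
    by_contra h
    rw [Set.not_nonempty_iff_eq_empty] at h
    simp [U, h] at hf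
  -- Suprema of subsolutions are subsolutions, so coordinates that are unbounded one by one can be
  -- made large simultaneously.
  have hbig : ∀ n : ℝ, ∃ k ∈ A, ∀ f ∈ U, n ≤ k f := by
    intro n
    have : ∀ V : Finset F, V ⊆ U → ∃ k ∈ A, ∀ f ∈ V, n ≤ k f := by
      intro V
      induction V using Finset.induction_on with
      | empty => exact fun _ => ⟨hA.some, hA.some_mem, by simp⟩
      | insert f V _ ih =>
        intro hV
        obtain ⟨k, hk, hkV⟩ := ih ((Finset.subset_insert _ _).trans hV)
        have hf : f ∈ U := hV (Finset.mem_insert_self _ _)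
        simp only [U, Finset.mem_filter, Finset.mem_univ, true_and] at hf
        push Not at hf
        obtain ⟨k', hk', hn⟩ := hf n
        refine ⟨k ⊔ k', ⟨fun g => le_sup_of_le_left (hk.1 g),
          curvatureMap_sup_le hΦ hk.1 hk'.1 hk.2 hk'.2⟩, fun g hg => ?_⟩
        rcases Finset.mem_insert.1 hg with rfl | hg
        · exact le_sup_of_le_right hn.le
        · exact le_sup_of_le_left (hkV g hg)
    exact this U subset_rfl
  have hB0 : ∀ f, f ∉ U → 0 ≤ B := fun f hf =>
    (hA.some_mem.1 f).trans (hB f hf _ hA.some_mem)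
  -- A lower bound for the contribution of e when all curvatures in U are at least n: both sides
  -- count if both 2-cells lie in U; otherwise only one side counts, with opposite curvature at most
  -- B. Either way the limit is 2Φ(e).
  let g : E → ℝ → ℝ := fun e n => if face e true ∈ U ∧ face e false ∈ U
    then bigonTotal (Φ e) n n else sideTotal (Φ e) n B
  have hg : Tendsto (fun n => ∑ e ∈ edgesWith face U, g e n) atTop
      (𝓝 (∑ e ∈ edgesWith face U, 2 * Φ e)) := by
    refine tendsto_finsetSum _ fun e _ => ?_
    simp only [g]
    split_ifs
    · exact tendsto_bigonTotal_diag (hΦ e).1 (hΦ e).2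
    · exact tendsto_sideTotal (hΦ e).1 (hΦ e).2 B
  have hle : ∀ n : ℝ, ∑ e ∈ edgesWith face U, g e n ≤ ∑ f ∈ U, L f := by
    intro n
    obtain ⟨k, hk, hkn⟩ := hbig n
    refine le_trans ?_ (Finset.sum_le_sum fun f _ => hk.2 f)
    rw [sum_curvatureMap]
    refine Finset.sum_le_sum fun e he => ?_
    have hs := sin_weight_pos hΦ e
    have key : ∀ f f', f ∈ U → f' ∉ U → sideTotal (Φ e) n B ≤ sideTotal (Φ e) (k f) (k f') :=
      fun f f' hf hf' => (sideTotal_mono hs (hkn f hf) (hB0 f' hf')).trans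
        (sideTotal_antitone hs (hk.1 f) (hB f' hf' k hk))
    rw [Fintype.sum_bool]
    simp only [Bool.not_true, Bool.not_false, g]
    by_cases h1 : face e true ∈ U <;> by_cases h2 : face e false ∈ U
    · simp only [h1, h2, and_self, if_true]
      exact bigonTotal_le hs (hkn _ h1) (hkn _ h2)
    · simp only [h1, h2, and_false, if_true, if_false, add_zero]
      exact key _ _ h1 h2
    · simp only [h1, h2, false_and, if_true, if_false, zero_add]
      exact key _ _ h2 h1
    · simp [edgesWith, h1, h2] at he
  have := le_of_tendsto' hg hle
  rw [← Finset.mul_sum] at this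
  exact this.not_gt (hL U hUn)

/-- Every admissible nonnegative vector is a vector of total curvatures. It is attained at the
vector `k` with maximal sum among those with curvatures at most `L`. -/
theorem exists_curvatureMap_eq [Fintype F] {L : F → ℝ} (hL0 : ∀ f, 0 ≤ L f)
    (hL : ∀ F' : Finset F, F'.Nonempty → ∑ f ∈ F', L f < 2 * ∑ e ∈ edgesWith face F', Φ e) :
    ∃ k : F → ℝ, (∀ f, 0 ≤ k f) ∧ ∀ f, curvatureMap face Φ k f = L f := by
  classical
  obtain ⟨B, hB⟩ := exists_bound_of_curvatureMap_le hΦ hL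
  let A : Set (F → ℝ) := {k | (∀ f, 0 ≤ k f) ∧ ∀ f, curvatureMap face Φ k f ≤ L f}
  have hAc : IsCompact A := by
    refine IsCompact.of_isClosed_subset (isCompact_Icc (a := 0) (b := fun _ => B)) ?_
      fun k hk => ⟨fun f => hk.1 f, fun f => hB k hk.1 hk.2 f⟩
    have h1 : IsClosed {k : F → ℝ | ∀ f, 0 ≤ k f} := by
      simp only [Set.ofPred_forall]
      exact isClosed_iInter fun f => isClosed_le continuous_const (continuous_apply f)
    have h2 : IsClosed {k : F → ℝ | ∀ f, curvatureMap face Φ k f ≤ L f} := by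
      simp only [Set.ofPred_forall]
      exact isClosed_iInter fun f => isClosed_le (continuous_curvatureMap hΦ f) continuous_const
    exact h1.inter h2
  have hA0 : (0 : F → ℝ) ∈ A :=
    ⟨fun _ => le_rfl, fun f => (curvatureMap_eq_zero (k := 0) rfl).trans_le (hL0 f)⟩
  obtain ⟨k, hk, hmax⟩ := hAc.exists_isMaxOn ⟨0, hA0⟩
    (f := fun k : F → ℝ => ∑ f, k f) (by fun_prop)
  refine ⟨k, hk.1, fun f => le_antisymm (hk.2 f) (le_of_not_gt fun hlt => ?_)⟩
  -- If the inequality at f is strict, k f can be raised slightly: continuity preserves the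
  -- inequality at f, and the other curvatures only decrease. This contradicts maximality of the
  -- sum.
  have hc : Continuous fun t : ℝ => curvatureMap face Φ (Function.update k f t) f :=
    (continuous_curvatureMap hΦ f).comp (continuous_const.update f continuous_id)
  have hev : ∀ᶠ t in 𝓝[>] (k f), curvatureMap face Φ (Function.update k f t) f < L f := by
    refine nhdsWithin_le_nhds (hc.tendsto (k f) |>.eventually_lt_const ?_)
    rwa [Function.update_eq_self]
  obtain ⟨t, ht, htk⟩ := (hev.and self_mem_nhdsWithin).exists
  have hle : k ≤ Function.update k f t := by
    intro g
    by_cases hg : g = f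
    · subst hg; simpa using le_of_lt htk
    · simp [hg]
  have hmem : Function.update k f t ∈ A := by
    refine ⟨fun g => (hk.1 g).trans (hle g), fun g => ?_⟩
    by_cases hg : g = f
    · subst hg; exact ht.le
    · exact (curvatureMap_le_of_le hΦ hk.1 hle (by simp [hg])).trans (hk.2 g)
  refine (hmax hmem).not_gt (Finset.sum_lt_sum (fun g _ => hle g) ⟨f, Finset.mem_univ _, ?_⟩)
  simpa using htk

end

end SphericalPattern

end

noncomputable section

namespace SphericalPattern

/-! ### Spherical trigonometry of the bigon -/

section

variable {φ r₁ r₂ : ℝ}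

/-- In the triangle of the two centres and an intersection point, with angle π - φ at the latter,
the three terms are cos D, sin D cos θ and sin D sin θ, where D is the distance of the centres and θ
the half angle at the first. -/
theorem cos_combination_sq (φ r₁ r₂ : ℝ) :
    (Real.cos r₁ * Real.cos r₂ - Real.sin r₁ * Real.sin r₂ * Real.cos φ) ^ 2 +
      ((Real.sin r₁ * Real.cos r₂ + Real.cos r₁ * Real.sin r₂ * Real.cos φ) ^ 2 +
        (Real.sin r₂ * Real.sin φ) ^ 2) = 1 := by
  have h1 := Real.sin_sq_add_cos_sq r₁
  have h2 := Real.sin_sq_add_cos_sq r₂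
  have h3 := Real.sin_sq_add_cos_sq φ
  linear_combination (Real.cos r₂ ^ 2 + Real.sin r₂ ^ 2 * Real.cos φ ^ 2) * h1 + h2 +
    Real.sin r₂ ^ 2 * h3

theorem cos_centerDist (φ r₁ r₂ : ℝ) : Real.cos (centerDist φ r₁ r₂) =
    Real.cos r₁ * Real.cos r₂ - Real.sin r₁ * Real.sin r₂ * Real.cos φ := by
  have h := cos_combination_sq φ r₁ r₂
  have h' := abs_le_of_sq_le_sq' (a := Real.cos r₁ * Real.cos r₂ -
    Real.sin r₁ * Real.sin r₂ * Real.cos φ) (b := 1) (by nlinarith) zero_le_one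
  exact Real.cos_arccos h'.1 h'.2

theorem sin_centerDist_sq (φ r₁ r₂ : ℝ) : Real.sin (centerDist φ r₁ r₂) ^ 2 =
    (Real.sin r₁ * Real.cos r₂ + Real.cos r₁ * Real.sin r₂ * Real.cos φ) ^ 2 +
      (Real.sin r₂ * Real.sin φ) ^ 2 := by
  have h := cos_combination_sq φ r₁ r₂
  rw [← cos_centerDist] at h
  linarith [Real.sin_sq_add_cos_sq (centerDist φ r₁ r₂)]

theorem sin_centerDist_pos (hφ : 0 < Real.sin φ) (h2 : 0 < Real.sin r₂) :
    0 < Real.sin (centerDist φ r₁ r₂) := by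
  refine lt_of_le_of_ne (Real.sin_nonneg_of_nonneg_of_le_pi (Real.arccos_nonneg _)
    (Real.arccos_le_pi _)) fun h => ?_
  have := sin_centerDist_sq φ r₁ r₂
  rw [← h] at this
  nlinarith [sq_pos_of_pos (mul_pos h2 hφ),
    sq_nonneg (Real.sin r₁ * Real.cos r₂ + Real.cos r₁ * Real.sin r₂ * Real.cos φ)]

/-- With A = sin r₁ cos r₂ + cos r₁ sin r₂ cos φ and B = sin r₂ sin φ, the law of cosines gives cos
θ = A / sin D, where D is the distance of the centres. Since A² + B² = sin² D, this is the angle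
with cotangent A / B. -/
theorem halfAngle_eq_theta (hφ : 0 < Real.sin φ) (h1 : 0 < Real.sin r₁) (h2 : 0 < Real.sin r₂) :
    halfAngle φ r₁ r₂ = theta φ (Real.cot r₁) (Real.cot r₂) := by
  have hd := sin_centerDist_pos (r₁ := r₁) hφ h2
  have hsq := sin_centerDist_sq φ r₁ r₂
  have hu : cotHalf φ (Real.cot r₁) (Real.cot r₂) =
      (Real.sin r₁ * Real.cos r₂ + Real.cos r₁ * Real.sin r₂ * Real.cos φ) /
        (Real.sin r₂ * Real.sin φ) := by
    have : √(1 + Real.cot r₁ ^ 2) = 1 / Real.sin r₁ := by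
      rw [Real.sqrt_eq_iff_eq_sq (by positivity) (by positivity), Real.cot_eq_cos_div_sin]
      field_simp
      linarith [Real.sin_sq_add_cos_sq r₁]
    rw [cotHalf, this, Real.cot_eq_cos_div_sin, Real.cot_eq_cos_div_sin]
    field_simp
  unfold halfAngle theta
  rw [hu, Real.arctan_eq_arcsin, Real.arccos, cos_centerDist]
  congr 2
  have hB : 0 < Real.sin r₂ * Real.sin φ := by positivity
  have hn : Real.cos r₂ - Real.cos r₁ *
      (Real.cos r₁ * Real.cos r₂ - Real.sin r₁ * Real.sin r₂ * Real.cos φ) =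
      Real.sin r₁ * (Real.sin r₁ * Real.cos r₂ + Real.cos r₁ * Real.sin r₂ * Real.cos φ) := by
    linear_combination (-Real.cos r₂) * Real.sin_sq_add_cos_sq r₁
  rw [hn, mul_div_mul_left _ _ h1.ne']
  generalize Real.sin r₁ * Real.cos r₂ + Real.cos r₁ * Real.sin r₂ * Real.cos φ = A at *
  generalize Real.sin r₂ * Real.sin φ = B at *
  have : √(1 + (A / B) ^ 2) = Real.sin (centerDist φ r₁ r₂) / B := by
    rw [Real.sqrt_eq_iff_eq_sq (by positivity) (by positivity), div_pow, div_pow, hsq]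
    field_simp
    ring
  rw [this]
  field_simp

theorem sideCurvature_eq_sideTotal (hφ : 0 < Real.sin φ) (h1 : 0 < Real.sin r₁)
    (h2 : 0 < Real.sin r₂) :
    sideCurvature φ r₁ r₂ = sideTotal φ (Real.cot r₁) (Real.cot r₂) := by
  have : √(1 + Real.cot r₁ ^ 2) = 1 / Real.sin r₁ := by
    rw [Real.sqrt_eq_iff_eq_sq (by positivity) (by positivity), Real.cot_eq_cos_div_sin]
    field_simp
    linarith [Real.sin_sq_add_cos_sq r₁]
  unfold sideCurvature sideLength sideTotal
  rw [halfAngle_eq_theta hφ h1 h2, this]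
  field_simp

theorem sin_mul_cos_halfAngle (hφ : 0 < Real.sin φ) (h1 : 0 < Real.sin r₁)
    (h2 : 0 < Real.sin r₂) :
    Real.sin (centerDist φ r₁ r₂) * Real.cos (halfAngle φ r₁ r₂) =
      Real.sin r₁ * Real.cos r₂ + Real.cos r₁ * Real.sin r₂ * Real.cos φ := by
  have hd := sin_centerDist_pos (r₁ := r₁) hφ h2
  have hsq := sin_centerDist_sq φ r₁ r₂
  have hn : Real.cos r₂ - Real.cos r₁ *
      (Real.cos r₁ * Real.cos r₂ - Real.sin r₁ * Real.sin r₂ * Real.cos φ) =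
      Real.sin r₁ * (Real.sin r₁ * Real.cos r₂ + Real.cos r₁ * Real.sin r₂ * Real.cos φ) := by
    linear_combination (-Real.cos r₂) * Real.sin_sq_add_cos_sq r₁
  unfold halfAngle
  rw [cos_centerDist, hn, mul_div_mul_left _ _ h1.ne']
  generalize Real.sin r₁ * Real.cos r₂ + Real.cos r₁ * Real.sin r₂ * Real.cos φ = A at *
  have h := abs_le_of_sq_le_sq' (a := A) (by nlinarith [sq_nonneg (Real.sin r₂ * Real.sin φ)]) hd.le
  rw [Real.cos_arccos]
  · field_simp
  · rw [le_div_iff₀ hd]; linarith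
  · rw [div_le_one hd]; linarith

theorem sin_halfAngle_pos (hφ : 0 < Real.sin φ) (h1 : 0 < Real.sin r₁) (h2 : 0 < Real.sin r₂) :
    0 < Real.sin (halfAngle φ r₁ r₂) := by
  rw [halfAngle_eq_theta hφ h1 h2, theta, Real.sin_pi_div_two_sub]
  exact Real.cos_arctan_pos _

end

end SphericalPattern

end

noncomputable section

namespace SphericalPattern

open InnerProductGeometry

/-! ### Parametrization of spherical quadrilaterals -/

instance : CompactSpace Square := by
  have hc : IsClosed {x : ℝ × ℝ | |x.1| + |x.2| ≤ 1} :=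
    isClosed_le (f := fun x : ℝ × ℝ => |x.1| + |x.2|) (by fun_prop) continuous_const
  refine isCompact_iff_compactSpace.1 (Metric.isCompact_of_isClosed_isBounded hc ?_)
  refine (Metric.isBounded_closedBall (x := (0 : ℝ × ℝ)) (r := 1)).subset fun x hx => ?_
  have hx : |x.1| + |x.2| ≤ 1 := hx
  rw [mem_closedBall_zero_iff, Prod.norm_def, Real.norm_eq_abs, Real.norm_eq_abs]
  exact max_le (by linarith [abs_nonneg x.2]) (by linarith [abs_nonneg x.1])

/-- The point of the cone over the spherical quadrilateral with the same barycentric coordinates as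
`x` in the upper or lower half of the model quadrilateral. -/
def quadVec (φ r₁ r₂ : ℝ) (x : Square) : E3 :=
  ((1 - |x.1.2| - x.1.1) / 2) • center φ r₁ r₂ false +
    ((1 - |x.1.2| + x.1.1) / 2) • center φ r₁ r₂ true +
    max (-x.1.2) 0 • corner φ r₁ r₂ false + max x.1.2 0 • corner φ r₁ r₂ true

theorem quadVec_coords (φ r₁ r₂ : ℝ) (x : Square) : quadVec φ r₁ r₂ x =
    !₂[(1 - |x.1.2| - x.1.1) / 2 + (1 - |x.1.2| + x.1.1) / 2 * Real.cos (centerDist φ r₁ r₂) +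
        |x.1.2| * Real.cos r₁,
      (1 - |x.1.2| + x.1.1) / 2 * Real.sin (centerDist φ r₁ r₂) +
        |x.1.2| * (Real.sin r₁ * Real.cos (halfAngle φ r₁ r₂)),
      x.1.2 * (Real.sin r₁ * Real.sin (halfAngle φ r₁ r₂))] := by
  have h1 := max_zero_add_max_neg_zero_eq_abs_self x.1.2
  have h2 := max_zero_sub_max_neg_zero_eq_self x.1.2
  ext i
  fin_cases i
  · simp [quadVec, center, corner]
    linear_combination Real.cos r₁ * h1
  · simp [quadVec, center, corner]
    linear_combination Real.sin r₁ * Real.cos (halfAngle φ r₁ r₂) * h1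
  · simp [quadVec, center, corner, sgn]
    linear_combination Real.sin r₁ * Real.sin (halfAngle φ r₁ r₂) * h2

theorem continuous_quadVec (φ r₁ r₂ : ℝ) : Continuous (quadVec φ r₁ r₂) := by
  unfold quadVec
  fun_prop

theorem abs_snd_le (x : Square) : |x.1.1| ≤ 1 - |x.1.2| := by linarith [x.2]

theorem norm_center (φ r₁ r₂ : ℝ) (s : Bool) : ‖center φ r₁ r₂ s‖ = 1 := by
  cases s <;> simp [center, EuclideanSpace.norm_eq, Fin.sum_univ_three]

theorem norm_corner (φ r₁ r₂ : ℝ) (t : Bool) : ‖corner φ r₁ r₂ t‖ = 1 := by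
  rw [EuclideanSpace.norm_eq, Real.sqrt_eq_one]
  have h := Real.sin_sq_add_cos_sq r₁
  have h' := Real.sin_sq_add_cos_sq (halfAngle φ r₁ r₂)
  cases t <;> simp [corner, Fin.sum_univ_three, sgn] <;>
  linear_combination Real.sin r₁ ^ 2 * h' + h

theorem quadVec_leg (φ r₁ r₂ : ℝ) (s t : Bool) (c : unitInterval) :
    quadVec φ r₁ r₂ (leg s t c) =
      (1 - (c : ℝ)) • center φ r₁ r₂ s + (c : ℝ) • corner φ r₁ r₂ t := by
  have h0 := c.2.1
  have e : ∀ y : ℝ, (1 - y + (1 - y)) / 2 = 1 - y := fun y => by ring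
  have e' : ∀ y : ℝ, (1 - y - (y - 1)) / 2 = 1 - y := fun y => by ring
  cases s <;> cases t <;> simp [quadVec, leg, sgn, abs_of_nonneg h0, h0, e, e']

theorem exists_smul_quadVec_eq (φ r₁ r₂ : ℝ) {α β y : ℝ} (hα : 0 ≤ α) (hβ : 0 ≤ β) (hpos : 0 < α + β + |y|) :
    ∃ x : Square, (α + β + |y|) • quadVec φ r₁ r₂ x =
      !₂[α + β * Real.cos (centerDist φ r₁ r₂) + |y| * Real.cos r₁,
        β * Real.sin (centerDist φ r₁ r₂) + |y| * (Real.sin r₁ * Real.cos (halfAngle φ r₁ r₂)),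
        y * (Real.sin r₁ * Real.sin (halfAngle φ r₁ r₂))] := by
  have habs : |β - α| ≤ α + β := abs_le.2 ⟨by linarith, by linarith⟩
  -- The weights of the two centres and of a corner are divided by their sum; the model point is the
  -- corresponding combination of model corners.
  refine ⟨⟨((β - α) / (α + β + |y|), y / (α + β + |y|)), ?_⟩, ?_⟩
  · simp only [abs_div, abs_of_pos hpos]
    rw [← add_div, div_le_one hpos]
    linarith
  · rw [quadVec_coords]
    simp only [abs_div, abs_of_pos hpos]
    ext i
    fin_cases i <;> simp <;> field_simp <;> ring

section

variable {φ r₁ r₂ : ℝ} (hφ : 0 < Real.sin φ) (h1 : 0 < Real.sin r₁) (h2 : 0 < Real.sin r₂)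
include hφ h1 h2

theorem inner_center_corner (s t : Bool) :
    inner ℝ (center φ r₁ r₂ s) (corner φ r₁ r₂ t) = Real.cos (cond s r₂ r₁) := by
  cases s
  · simp [center, corner, PiLp.inner_apply, Fin.sum_univ_three]
  · simp only [center, corner, PiLp.inner_apply, Fin.sum_univ_three, cond_true]
    simp
    linear_combination Real.sin r₁ * sin_mul_cos_halfAngle hφ h1 h2 +
      Real.cos r₁ * cos_centerDist φ r₁ r₂ + Real.cos r₂ * Real.sin_sq_add_cos_sq r₁

theorem quadVec_ne_zero (x : Square) : quadVec φ r₁ r₂ x ≠ 0 := by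
  intro h
  have hd := sin_centerDist_pos (r₁ := r₁) hφ h2
  have hw := mul_pos h1 (sin_halfAngle_pos hφ h1 h2)
  rw [quadVec_coords] at h
  have e0 := congrArg (fun v : E3 => v 0) h
  have e1 := congrArg (fun v : E3 => v 1) h
  have e2 := congrArg (fun v : E3 => v 2) h
  simp at e0 e1 e2
  have hy : x.1.2 = 0 := by
    rcases e2 with h | h | h
    · exact h
    · exact absurd h h1.ne'
    · exact absurd h (sin_halfAngle_pos hφ h1 h2).ne'
  rw [hy] at e0 e1
  simp [hd.ne'] at e0 e1
  rw [e1] at e0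
  simp at e0
  linarith

/-- Scaling-invariant injectivity of the cone parametrization. -/
theorem quadVec_injective {x y : Square} {a : ℝ} (ha : 0 ≤ a)
    (h : quadVec φ r₁ r₂ x = a • quadVec φ r₁ r₂ y) : x = y := by
  have hd := sin_centerDist_pos (r₁ := r₁) hφ h2
  have hw := mul_pos h1 (sin_halfAngle_pos hφ h1 h2)
  rw [quadVec_coords, quadVec_coords] at h
  have e0 := congrArg (fun v : E3 => v 0) h
  have e1 := congrArg (fun v : E3 => v 1) h
  have e2 := congrArg (fun v : E3 => v 2) h
  simp only [PiLp.smul_apply, smul_eq_mul, Matrix.cons_val_zero,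
    Matrix.cons_val_one, Matrix.cons_val] at e0 e1 e2
  have hy : x.1.2 = a * y.1.2 := mul_right_cancel₀ hw.ne' (by linear_combination e2)
  have hy' : |x.1.2| = a * |y.1.2| := by rw [hy, abs_mul, abs_of_nonneg ha]
  have hb : (1 - |x.1.2| + x.1.1) / 2 = a * ((1 - |y.1.2| + y.1.1) / 2) :=
    mul_right_cancel₀ hd.ne' (by
      linear_combination e1 - Real.sin r₁ * Real.cos (halfAngle φ r₁ r₂) * hy')
  have hc : (1 - |x.1.2| - x.1.1) / 2 = a * ((1 - |y.1.2| - y.1.1) / 2) := by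
    linear_combination e0 - Real.cos r₁ * hy' - Real.cos (centerDist φ r₁ r₂) * hb
  have ha1 : a = 1 := by linear_combination -(hb + hc + hy')
  subst ha1
  refine Subtype.ext (Prod.ext ?_ ?_)
  · linear_combination hb - hc
  · linear_combination hy

end

section

variable {φ r₁ r₂ : ℝ} (hφ : 0 < φ ∧ φ < Real.pi / 2) (h1 : 0 < r₁ ∧ r₁ ≤ Real.pi / 2)
  (h2 : 0 < r₂ ∧ r₂ ≤ Real.pi / 2)

theorem sin_pos_of_pos_of_le {r : ℝ} (h : 0 < r ∧ r ≤ Real.pi / 2) : 0 < Real.sin r :=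
  Real.sin_pos_of_pos_of_lt_pi h.1 (by linarith [h.2, Real.pi_pos])

theorem cos_nonneg_of_pos_of_le {r : ℝ} (h : 0 < r ∧ r ≤ Real.pi / 2) : 0 ≤ Real.cos r :=
  Real.cos_nonneg_of_mem_Icc ⟨by linarith [h.1], h.2⟩

include hφ h1 h2

theorem cos_halfAngle_nonneg : 0 ≤ Real.cos (halfAngle φ r₁ r₂) := by
  have hs := sin_pos_of_pos_of_le ⟨hφ.1, hφ.2.le⟩
  have hc := cos_nonneg_of_pos_of_le ⟨hφ.1, hφ.2.le⟩
  have h1s := sin_pos_of_pos_of_le h1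
  have h2s := sin_pos_of_pos_of_le h2
  have h1c := cos_nonneg_of_pos_of_le h1
  have h2c := cos_nonneg_of_pos_of_le h2
  have hd := sin_centerDist_pos (r₁ := r₁) hs h2s
  have h := sin_mul_cos_halfAngle hs h1s h2s
  refine nonneg_of_mul_nonneg_right (b := Real.cos (halfAngle φ r₁ r₂)) ?_ hd
  rw [h]
  positivity

/-- Up to a positive factor this is the coefficient of the first centre when the sum of the two
corners is written in terms of the centres. Multiplied by the sine of the centre distance, it
becomes the expression of `sin_mul_cos_halfAngle` with the disks exchanged, times sin r₂. Its sign
puts the midpoint of the corners between the centres, so the quadrilateral splits into two triangles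
along the segment joining them. -/
theorem midpoint_coefficient_nonneg : 0 ≤ Real.cos r₁ * Real.sin (centerDist φ r₁ r₂) -
    Real.sin r₁ * Real.cos (halfAngle φ r₁ r₂) * Real.cos (centerDist φ r₁ r₂) := by
  have hs := sin_pos_of_pos_of_le ⟨hφ.1, hφ.2.le⟩
  have hc := cos_nonneg_of_pos_of_le ⟨hφ.1, hφ.2.le⟩
  have h1s := sin_pos_of_pos_of_le h1
  have h2s := sin_pos_of_pos_of_le h2
  have h1c := cos_nonneg_of_pos_of_le h1
  have h2c := cos_nonneg_of_pos_of_le h2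
  have hd := sin_centerDist_pos (r₁ := r₁) hs h2s
  have h := sin_mul_cos_halfAngle hs h1s h2s
  refine nonneg_of_mul_nonneg_right (a := Real.sin (centerDist φ r₁ r₂)) ?_ hd
  have : Real.sin (centerDist φ r₁ r₂) * (Real.cos r₁ * Real.sin (centerDist φ r₁ r₂) -
      Real.sin r₁ * Real.cos (halfAngle φ r₁ r₂) * Real.cos (centerDist φ r₁ r₂)) =
      Real.sin r₂ * (Real.sin r₂ * Real.cos r₁ + Real.cos r₂ * Real.sin r₁ * Real.cos φ) := by
    linear_combination Real.cos r₁ * Real.sin_sq_add_cos_sq (centerDist φ r₁ r₂)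
      - Real.sin r₁ * Real.cos (centerDist φ r₁ r₂) * h
      - (Real.cos (centerDist φ r₁ r₂) * Real.cos r₁ + Real.cos r₂) * cos_centerDist φ r₁ r₂
      - Real.cos (centerDist φ r₁ r₂) * Real.cos r₂ * Real.sin_sq_add_cos_sq r₁
      - Real.cos r₁ * Real.sin_sq_add_cos_sq r₂
  rw [this]
  positivity

/-- The normalized parametrization of the spherical quadrilateral. -/
def quadPoint (x : Square) : quad φ r₁ r₂ :=
  ⟨‖quadVec φ r₁ r₂ x‖⁻¹ • quadVec φ r₁ r₂ x, by
    have hne := quadVec_ne_zero (sin_pos_of_pos_of_le ⟨hφ.1, hφ.2.le⟩) (sin_pos_of_pos_of_le h1)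
      (sin_pos_of_pos_of_le h2) x
    have hx := abs_le.1 (abs_snd_le x)
    refine ⟨norm_smul_inv_norm hne, ‖quadVec φ r₁ r₂ x‖⁻¹ * ((1 - |x.1.2| - x.1.1) / 2),
      ‖quadVec φ r₁ r₂ x‖⁻¹ * ((1 - |x.1.2| + x.1.1) / 2),
      ‖quadVec φ r₁ r₂ x‖⁻¹ * max (-x.1.2) 0, ‖quadVec φ r₁ r₂ x‖⁻¹ * max x.1.2 0,
      mul_nonneg (by positivity) (by linarith), mul_nonneg (by positivity) (by linarith),
      by positivity, by positivity, ?_⟩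
    simp only [mul_smul, ← smul_add]
    rfl⟩

theorem continuous_quadPoint : Continuous (quadPoint hφ h1 h2) := by
  have hne := quadVec_ne_zero (sin_pos_of_pos_of_le ⟨hφ.1, hφ.2.le⟩) (sin_pos_of_pos_of_le h1)
      (sin_pos_of_pos_of_le h2)
  have hc := continuous_quadVec φ r₁ r₂
  exact ((hc.norm.inv₀ fun x => norm_ne_zero_iff.2 (hne x)).smul hc).subtype_mk _

theorem quadPoint_injective : Function.Injective (quadPoint hφ h1 h2) := by
  intro x y h
  have hs := sin_pos_of_pos_of_le ⟨hφ.1, hφ.2.le⟩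
  have h1s := sin_pos_of_pos_of_le h1
  have h2s := sin_pos_of_pos_of_le h2
  have hx := norm_ne_zero_iff.2 (quadVec_ne_zero hs h1s h2s x)
  have h' : ‖quadVec φ r₁ r₂ x‖⁻¹ • quadVec φ r₁ r₂ x =
    ‖quadVec φ r₁ r₂ y‖⁻¹ • quadVec φ r₁ r₂ y := congrArg Subtype.val h
  refine quadVec_injective hs h1s h2s
    (a := ‖quadVec φ r₁ r₂ x‖ * ‖quadVec φ r₁ r₂ y‖⁻¹) (by positivity) ?_
  rw [mul_smul, ← h', smul_smul, mul_inv_cancel₀ hx, one_smul]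

theorem quadPoint_surjective : Function.Surjective (quadPoint hφ h1 h2) := by
  rintro ⟨z, hz, a, b, c, d, ha, hb, hc, hd, rfl⟩
  have hs := sin_pos_of_pos_of_le ⟨hφ.1, hφ.2.le⟩
  have h1s := sin_pos_of_pos_of_le h1
  have h2s := sin_pos_of_pos_of_le h2
  have hD := sin_centerDist_pos (r₁ := r₁) hs h2s
  -- The common part m of the two corner weights is a multiple of the sum of the corners and is
  -- absorbed into the centres. At most one corner, with weight |d - c|, remains.
  set m := min c d with hm
  have hm0 : 0 ≤ m := le_min hc hd
  have hμ := midpoint_coefficient_nonneg hφ h1 h2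
  have hν := mul_nonneg h1s.le (cos_halfAngle_nonneg hφ h1 h2)
  have hcd : |d - c| = c + d - 2 * m := by
    rcases le_total c d with h | h
    · rw [abs_of_nonneg (by linarith), hm, min_eq_left h]; ring
    · rw [abs_of_nonpos (by linarith), hm, min_eq_right h]; ring
  set α := a + 2 * m * ((Real.cos r₁ * Real.sin (centerDist φ r₁ r₂) -
    Real.sin r₁ * Real.cos (halfAngle φ r₁ r₂) * Real.cos (centerDist φ r₁ r₂)) /
      Real.sin (centerDist φ r₁ r₂)) with hαdef
  set β := b + 2 * m * (Real.sin r₁ * Real.cos (halfAngle φ r₁ r₂) /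
    Real.sin (centerDist φ r₁ r₂)) with hβdef
  have hα : 0 ≤ α := by positivity
  have hβ : 0 ≤ β := by positivity
  have hzeq : a • center φ r₁ r₂ false + b • center φ r₁ r₂ true + c • corner φ r₁ r₂ false +
      d • corner φ r₁ r₂ true =
      !₂[α + β * Real.cos (centerDist φ r₁ r₂) + |d - c| * Real.cos r₁,
        β * Real.sin (centerDist φ r₁ r₂) +
          |d - c| * (Real.sin r₁ * Real.cos (halfAngle φ r₁ r₂)),
        (d - c) * (Real.sin r₁ * Real.sin (halfAngle φ r₁ r₂))] := by
    rw [hcd, hαdef, hβdef]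
    ext i
    fin_cases i
    · simp [center, corner]; field_simp; ring
    · simp [center, corner]; field_simp; ring
    · simp [center, corner, sgn]; ring
  have hT : 0 < α + β + |d - c| := by
    refine lt_of_le_of_ne (by positivity) fun h0 => ?_
    have e1 : α = 0 := by linarith [abs_nonneg (d - c)]
    have e2 : β = 0 := by linarith [abs_nonneg (d - c)]
    have e3 : |d - c| = 0 := by linarith [abs_nonneg (d - c)]
    rw [hzeq, e1, e2, e3, abs_eq_zero.1 e3] at hz
    simp [EuclideanSpace.norm_eq, Fin.sum_univ_three] at hz
  obtain ⟨x, hx⟩ := exists_smul_quadVec_eq φ r₁ r₂ (y := d - c) hα hβ hT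
  refine ⟨x, Subtype.ext ?_⟩
  refine Eq.trans (b := ‖quadVec φ r₁ r₂ x‖⁻¹ • quadVec φ r₁ r₂ x) rfl (Eq.trans ?_ hzeq.symm)
  rw [hzeq] at hz
  rw [← hx, norm_smul, Real.norm_of_nonneg hT.le] at hz
  rw [← hx, eq_inv_of_mul_eq_one_left hz]

/-- The model quadrilateral is homeomorphic to the spherical quadrilateral. -/
def quadHomeomorph : Square ≃ₜ quad φ r₁ r₂ :=
  (Continuous.homeoOfEquivCompactToT2 (f := Equiv.ofBijective (quadPoint hφ h1 h2)
    ⟨quadPoint_injective hφ h1 h2, quadPoint_surjective hφ h1 h2⟩)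
    (continuous_quadPoint hφ h1 h2))

theorem quadHomeomorph_leg (s t : Bool) (c : unitInterval) :
    ∃ a : ℝ, 0 < a ∧ (quadHomeomorph hφ h1 h2 (leg s t c) : E3) =
      a • ((1 - (c : ℝ)) • center φ r₁ r₂ s + (c : ℝ) • corner φ r₁ r₂ t) := by
  have hne := quadVec_ne_zero (sin_pos_of_pos_of_le ⟨hφ.1, hφ.2.le⟩) (sin_pos_of_pos_of_le h1)
      (sin_pos_of_pos_of_le h2) (leg s t c)
  refine ⟨‖quadVec φ r₁ r₂ (leg s t c)‖⁻¹, inv_pos.2 (norm_pos_iff.2 hne), ?_⟩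
  rw [← quadVec_leg]
  rfl

theorem quadHomeomorph_leg_zero (s t : Bool) :
    (quadHomeomorph hφ h1 h2 (leg s t 0) : E3) = center φ r₁ r₂ s := by
  show ‖quadVec φ r₁ r₂ (leg s t 0)‖⁻¹ • quadVec φ r₁ r₂ (leg s t 0) = _
  rw [quadVec_leg]
  simp [norm_center]

theorem quadHomeomorph_leg_one (s t : Bool) :
    (quadHomeomorph hφ h1 h2 (leg s t 1) : E3) = corner φ r₁ r₂ t := by
  show ‖quadVec φ r₁ r₂ (leg s t 1)‖⁻¹ • quadVec φ r₁ r₂ (leg s t 1) = _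
  rw [quadVec_leg]
  simp [norm_corner]

theorem angle_quadHomeomorph_leg (s t : Bool) (c : unitInterval) :
    angle (quadHomeomorph hφ h1 h2 (leg s t 0) : E3) (quadHomeomorph hφ h1 h2 (leg s t c)) +
      angle (quadHomeomorph hφ h1 h2 (leg s t c) : E3) (quadHomeomorph hφ h1 h2 (leg s t 1)) =
    angle (quadHomeomorph hφ h1 h2 (leg s t 0) : E3) (quadHomeomorph hφ h1 h2 (leg s t 1)) := by
  obtain ⟨a, ha, he⟩ := quadHomeomorph_leg hφ h1 h2 s t c
  rw [quadHomeomorph_leg_zero, quadHomeomorph_leg_one]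
  refine (angle_eq_angle_add_add_angle_add_of_mem_span ?_ ?_).symm
  · intro h0
    have := (quadHomeomorph hφ h1 h2 (leg s t c)).2.1
    rw [h0, norm_zero] at this
    exact zero_ne_one this
  · rw [he, Submodule.mem_span_pair]
    refine ⟨⟨a * (1 - c), mul_nonneg ha.le (by linarith [c.2.2])⟩,
      ⟨a * c, mul_nonneg ha.le c.2.1⟩, ?_⟩
    simp only [smul_add, smul_smul]
    rfl

/-- The parametrization of a side from a centre depends only on the radius. -/
theorem angle_quadHomeomorph_center (s t : Bool) (c : unitInterval) :
    angle (quadHomeomorph hφ h1 h2 (leg s t 0) : E3) (quadHomeomorph hφ h1 h2 (leg s t c)) =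
      Real.arccos (((1 - c) + c * Real.cos (cond s r₂ r₁)) /
        √((1 - c) ^ 2 + 2 * ((1 - c) * (c * Real.cos (cond s r₂ r₁))) + c ^ 2)) := by
  obtain ⟨a, ha, he⟩ := quadHomeomorph_leg hφ h1 h2 s t c
  have hi := inner_center_corner (sin_pos_of_pos_of_le ⟨hφ.1, hφ.2.le⟩)
    (sin_pos_of_pos_of_le h1) (sin_pos_of_pos_of_le h2) s t
  rw [quadHomeomorph_leg_zero, he, angle_smul_right_of_pos _ _ ha, angle, norm_center, one_mul,
    inner_add_right, real_inner_smul_right, real_inner_smul_right, hi,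
    real_inner_self_eq_norm_sq, norm_center]
  congr 2
  · ring
  · rw [eq_comm, Real.sqrt_eq_iff_eq_sq _ (norm_nonneg _), norm_add_sq_real,
      real_inner_smul_left, real_inner_smul_right, hi, norm_smul, norm_smul, norm_center,
      norm_corner]
    · simp
    · have := norm_add_sq_real ((1 - (c : ℝ)) • center φ r₁ r₂ s) ((c : ℝ) • corner φ r₁ r₂ t)
      rw [real_inner_smul_left, real_inner_smul_right, hi, norm_smul, norm_smul, norm_center,
        norm_corner] at this
      simp only [Real.norm_eq_abs, mul_one, sq_abs] at this
      rw [← this]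
      positivity

end

end SphericalPattern

end

noncomputable section

namespace SphericalPattern

open InnerProductGeometry

/-! ### Conical metrics with given radii -/

/-- A point on a geodesic segment is determined by its distance from an end point. -/
theorem eq_of_angle_eq_of_mem_segment {c n p q : E3} (hp : ‖p‖ = 1) (hq : ‖q‖ = 1)
    (hcn : angle c n ≠ Real.pi) (hp' : angle c p + angle p n = angle c n)
    (hq' : angle c q + angle q n = angle c n) (h : angle c p = angle c q) : p = q := by
  have hp0 : p ≠ 0 := by rintro rfl; simp at hp
  have hq0 : q ≠ 0 := by rintro rfl; simp at hq
  have hpm := ((angle_eq_angle_add_angle_iff hp0).1 hp'.symm).resolve_left hcn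
  have hqm := ((angle_eq_angle_add_angle_iff hq0).1 hq'.symm).resolve_left hcn
  rw [Submodule.mem_span_pair] at hpm hqm
  obtain ⟨a, b, hab⟩ := hpm
  obtain ⟨a', b', hab'⟩ := hqm
  -- Equal distances to both ends make p - q orthogonal to c and n; as it also lies in their span,
  -- it vanishes.
  have hc : inner ℝ (p - q) c = 0 := by
    have h1 := cos_angle_mul_norm_mul_norm c p
    have h2 := cos_angle_mul_norm_mul_norm c q
    rw [hp, h] at h1
    rw [hq] at h2
    rw [inner_sub_left, real_inner_comm, real_inner_comm c q, ← h1, ← h2, sub_self]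
  have hn : inner ℝ (p - q) n = 0 := by
    have h1 := cos_angle_mul_norm_mul_norm p n
    have h2 := cos_angle_mul_norm_mul_norm q n
    have h3 : angle p n = angle q n := by linarith
    rw [hp, h3] at h1
    rw [hq] at h2
    rw [inner_sub_left, ← h1, ← h2, sub_self]
  have key : inner ℝ (p - q) (p - q) = 0 := by
    nth_rw 2 [← hab, ← hab']
    simp only [NNReal.smul_def, inner_sub_right, inner_add_right, real_inner_smul_right, hc, hn,
      mul_zero, add_zero, sub_zero]
  exact sub_eq_zero.1 (inner_self_eq_zero.1 key)

theorem continuous_leg (s t : Bool) : Continuous (leg s t) := by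
  unfold leg
  fun_prop

namespace ConicalMetric

section

variable {S : Type*} [TopologicalSpace S] {E F : Type*} {D : CellDecomposition S E F} {Φ : E → ℝ}

theorem _root_.SphericalPattern.CellDecomposition.face_eq_of_next
    (D : CellDecomposition S E F) {e e' : E} {s t s' t' : Bool}
    (h : D.next (e, s, t) = (e', s', t')) : D.face e s = D.face e' s' :=
  (D.face_eq_iff e s e' s').2 (Relation.EqvGen.rel _ _ ⟨t, t', h⟩)

/-- The conical metric with circle pattern of given radii. -/
def ofRadius (D : CellDecomposition S E F) (hΦ : ∀ e, 0 < Φ e ∧ Φ e < Real.pi / 2) (r : F → ℝ)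
    (hr : ∀ f, 0 < r f ∧ r f ≤ Real.pi / 2) : ConicalMetric D Φ where
  radius := r
  radius_pos f := (hr f).1
  radius_le f := (hr f).2
  coord e := quadHomeomorph (hΦ e) (hr _) (hr _)
  coord_center e s t := quadHomeomorph_leg_zero _ _ _ s t
  coord_corner e s t := quadHomeomorph_leg_one _ _ _ s t
  coord_leg e s t c := angle_quadHomeomorph_leg _ _ _ s t c
  coord_glue e s t e' s' t' c h := by
    -- Identified sides start at the centre of the same 2-cell, and the parametrization depends only
    -- on its radius.
    have hf := D.face_eq_of_next h
    have hc : ∀ e s, cond s (r (D.face e true)) (r (D.face e false)) = r (D.face e s) := by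
      intro e s; cases s <;> rfl
    rw [angle_quadHomeomorph_center, angle_quadHomeomorph_center, hc, hc, hf]

/-! ### Distances along the sides of the quadrilaterals -/

theorem norm_coord (M : ConicalMetric D Φ) (e : E) (x : Square) : ‖(M.coord e x : E3)‖ = 1 :=
  (M.coord e x).2.1

theorem coord_ne_zero (M : ConicalMetric D Φ) (e : E) (x : Square) : (M.coord e x : E3) ≠ 0 := by
  rw [← norm_ne_zero_iff, M.norm_coord]
  exact one_ne_zero

/-- Distance from the centre along a side of a quadrilateral. -/
def legAngle (M : ConicalMetric D Φ) (e : E) (s t : Bool) (c : unitInterval) : ℝ :=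
  angle (M.coord e (leg s t 0) : E3) (M.coord e (leg s t c))

theorem legAngle_zero (M : ConicalMetric D Φ) (e : E) (s t : Bool) : M.legAngle e s t 0 = 0 :=
  angle_self (M.coord_ne_zero e _)

theorem continuous_legAngle (M : ConicalMetric D Φ) (e : E) (s t : Bool) :
    Continuous (M.legAngle e s t) := by
  have h : Continuous fun c => (M.coord e (leg s t c) : E3) :=
    continuous_subtype_val.comp ((M.coord e).continuous.comp (continuous_leg s t))
  refine continuous_iff_continuousAt.2 fun c => ?_
  exact ContinuousAt.comp
    (f := fun c => ((M.coord e (leg s t 0) : E3), (M.coord e (leg s t c) : E3)))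
    (continuousAt_angle (M.coord_ne_zero e _) (M.coord_ne_zero e _))
    (continuousAt_const.prodMk h.continuousAt)

theorem legAngle_le (M : ConicalMetric D Φ) (e : E) (s t : Bool) (c : unitInterval) :
    M.legAngle e s t c ≤ M.legAngle e s t 1 := by
  have := M.coord_leg e s t c
  unfold legAngle
  linarith [angle_nonneg (M.coord e (leg s t c) : E3) (M.coord e (leg s t 1))]

/-- The length of a side has the same cosine as the radius of its 2-cell, hence a nonnegative one.
The end points are therefore not antipodal, and the geodesic between them is unique. -/
theorem legAngle_one_ne_pi (M : ConicalMetric D Φ) (hΦ : ∀ e, 0 < Φ e ∧ Φ e < Real.pi / 2) (e : E)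
    (s t : Bool) : M.legAngle e s t 1 ≠ Real.pi := by
  intro h
  have hr : ∀ f, 0 < M.radius f ∧ M.radius f ≤ Real.pi / 2 :=
    fun f => ⟨M.radius_pos f, M.radius_le f⟩
  have hi := inner_center_corner (sin_pos_of_pos_of_le ⟨(hΦ e).1, (hΦ e).2.le⟩)
    (sin_pos_of_pos_of_le (hr (D.face e false))) (sin_pos_of_pos_of_le (hr (D.face e true))) s t
  have hcos := cos_angle_mul_norm_mul_norm (M.coord e (leg s t 0) : E3) (M.coord e (leg s t 1))
  rw [norm_coord, norm_coord, show angle _ _ = Real.pi from h, M.coord_center, M.coord_corner, hi,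
    Real.cos_pi] at hcos
  have : 0 ≤ Real.cos (cond s (M.radius (D.face e true)) (M.radius (D.face e false))) := by
    cases s <;> exact cos_nonneg_of_pos_of_le (hr _)
  linarith

theorem legAngle_next (M : ConicalMetric D Φ) {e e' : E} {s t s' t' : Bool} (c : unitInterval)
    (h : D.next (e, s, t) = (e', s', t')) : M.legAngle e s t c = M.legAngle e' s' t' c :=
  M.coord_glue e s t e' s' t' c h

/-! ### The isometry between metrics with equal radii -/

variable {M M' : ConicalMetric D Φ}

/-- Equal radii give literally the same spherical quadrilaterals, so one coordinate map can be
followed by the inverse of the other. -/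
theorem exists_coord_transfer (hr : M.radius = M'.radius) :
    ∃ τ : E → Square ≃ₜ Square, ∀ e x, (M'.coord e (τ e x) : E3) = M.coord e x := by
  have h : ∀ e, quad (Φ e) (M.radius (D.face e false)) (M.radius (D.face e true)) =
      quad (Φ e) (M'.radius (D.face e false)) (M'.radius (D.face e true)) := fun e => by rw [hr]
  refine ⟨fun e => (M.coord e).trans ((Homeomorph.setCongr (h e)).trans (M'.coord e).symm),
    fun e x => ?_⟩
  simp
  rfl

theorem legAngle_one_eq (hr : M.radius = M'.radius) (e : E) (s t : Bool) :
    M.legAngle e s t 1 = M'.legAngle e s t 1 := by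
  unfold legAngle
  rw [M.coord_center, M.coord_corner, M'.coord_center, M'.coord_corner, hr]

/-- Intermediate value theorem: distances along a side range continuously from 0 to the same total
length in both metrics. -/
theorem exists_legAngle_eq (hr : M.radius = M'.radius) (e : E) (s t : Bool) (c : unitInterval) :
    ∃ c', M'.legAngle e s t c' = M.legAngle e s t c := by
  refine mem_range_of_exists_le_of_exists_ge (M'.continuous_legAngle e s t) ⟨0, ?_⟩ ⟨1, ?_⟩
  · rw [legAngle_zero]; exact angle_nonneg _ _
  · rw [← legAngle_one_eq hr]; exact M.legAngle_le e s t c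

theorem transfer_leg (hΦ : ∀ e, 0 < Φ e ∧ Φ e < Real.pi / 2) (hr : M.radius = M'.radius)
    {τ : E → Square ≃ₜ Square} (hτ : ∀ e x, (M'.coord e (τ e x) : E3) = M.coord e x)
    {e : E} {s t : Bool} {c c' : unitInterval} (h : M'.legAngle e s t c' = M.legAngle e s t c) :
    τ e (leg s t c) = leg s t c' := by
  refine (M'.coord e).injective (Subtype.ext ?_)
  rw [hτ]
  have h0 : (M.coord e (leg s t 0) : E3) = M'.coord e (leg s t 0) := by
    rw [M.coord_center, M'.coord_center, hr]
  have h1 : (M.coord e (leg s t 1) : E3) = M'.coord e (leg s t 1) := by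
    rw [M.coord_corner, M'.coord_corner, hr]
  refine eq_of_angle_eq_of_mem_segment (M.norm_coord e _) (M'.norm_coord e _)
    (M.legAngle_one_ne_pi hΦ e s t) (M.coord_leg e s t c) ?_ ?_
  · rw [h0, h1]; exact M'.coord_leg e s t c'
  · rw [show angle _ _ = _ from h.symm, h0]; rfl

/-- Each side is merely reparametrized by distance from the centre. Both metrics glue isometrically,
so the same new parameter c' serves on the two identified sides. -/
theorem transfer_glue (hΦ : ∀ e, 0 < Φ e ∧ Φ e < Real.pi / 2) (hr : M.radius = M'.radius)
    {τ : E → Square ≃ₜ Square} (hτ : ∀ e x, (M'.coord e (τ e x) : E3) = M.coord e x)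
    {x y : E × Square} (h : Relation.EqvGen (Glue D.next) x y) :
    Relation.EqvGen (Glue D.next) (x.1, τ x.1 x.2) (y.1, τ y.1 y.2) := by
  induction h with
  | rel x y h =>
    obtain ⟨⟨e, s, t⟩, c, rfl, rfl⟩ := h
    obtain ⟨c', hc'⟩ := exists_legAngle_eq hr e s t c
    rcases hn : D.next (e, s, t) with ⟨e', s', t'⟩
    have hc'' : M'.legAngle e' s' t' c' = M.legAngle e' s' t' c := by
      rw [← M.legAngle_next c hn, ← M'.legAngle_next c' hn, hc']
    refine Relation.EqvGen.rel _ _ ⟨(e, s, t), c', ?_, ?_⟩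
    · simp only [transfer_leg hΦ hr hτ hc']
    · simp only [hn, transfer_leg hΦ hr hτ hc'']
  | refl x => exact Relation.EqvGen.refl _
  | symm x y _ ih => exact Relation.EqvGen.symm _ _ ih
  | trans x y z _ _ ih ih' => exact Relation.EqvGen.trans _ _ _ ih ih'

/-- A continuous map from a finite union of compact squares to a Hausdorff space is closed. This
makes maps defined chart by chart continuous on S. -/
theorem _root_.SphericalPattern.CellDecomposition.isQuotientMap_charts [Finite E] [T2Space S]
    (D : CellDecomposition S E F) :
    Topology.IsQuotientMap fun p : Σ _ : E, Square => D.chart p.1 p.2 := by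
  have hc : Continuous fun p : Σ _ : E, Square => D.chart p.1 p.2 :=
    continuous_sigma D.continuous_chart
  refine hc.isClosedMap.isQuotientMap hc fun p => ?_
  obtain ⟨e, x, h⟩ := D.chart_surjective p
  exact ⟨⟨e, x⟩, h⟩

theorem exists_transfer_map [Finite E] [T2Space S] (hΦ : ∀ e, 0 < Φ e ∧ Φ e < Real.pi / 2)
    (hr : M.radius = M'.radius) {τ : E → Square ≃ₜ Square}
    (hτ : ∀ e x, (M'.coord e (τ e x) : E3) = M.coord e x) :
    ∃ ψ : S → S, Continuous ψ ∧ ∀ e x, ψ (D.chart e x) = D.chart e (τ e x) := by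
  choose ε ξ hεξ using D.chart_surjective
  have hψ : ∀ e x, D.chart (ε (D.chart e x)) (τ (ε (D.chart e x)) (ξ (D.chart e x))) = D.chart e (τ e x) := by
    intro e x
    rw [D.chart_eq_iff]
    exact transfer_glue hΦ hr hτ ((D.chart_eq_iff _ _ _ _).1 (hεξ (D.chart e x)))
  refine ⟨fun p => D.chart (ε p) (τ (ε p) (ξ p)), ?_, hψ⟩
  rw [D.isQuotientMap_charts.continuous_iff]
  simp only [Function.comp_def, hψ]
  exact continuous_sigma fun e => (D.continuous_chart e).comp (τ e).continuous

theorem localDist_map_le {τ : E → Square ≃ₜ Square}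
    (hτ : ∀ e x, (M'.coord e (τ e x) : E3) = M.coord e x) {ψ : S → S}
    (hψ : ∀ e x, ψ (D.chart e x) = D.chart e (τ e x)) (p q : S) :
    M'.localDist (ψ p) (ψ q) ≤ M.localDist p q := by
  refine le_iInf fun e => le_iInf fun x => le_iInf fun y => le_iInf fun h => ?_
  refine iInf_le_of_le e (iInf_le_of_le (τ e x) (iInf_le_of_le (τ e y) (iInf_le_of_le ?_ ?_)))
  · rw [← hψ, ← hψ, h.1, h.2]; exact ⟨rfl, rfl⟩
  · rw [hτ, hτ]

/-- Chains of points are carried to chains of no greater length; the reverse inequality comes from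
the same statement for the inverse map. -/
theorem dist_map_le {τ : E → Square ≃ₜ Square}
    (hτ : ∀ e x, (M'.coord e (τ e x) : E3) = M.coord e x) {ψ : S → S}
    (hψ : ∀ e x, ψ (D.chart e x) = D.chart e (τ e x)) (p q : S) :
    M'.dist (ψ p) (ψ q) ≤ M.dist p q := by
  refine le_iInf fun n => le_iInf fun z => le_iInf fun h => ?_
  refine iInf_le_of_le n (iInf_le_of_le (fun i => ψ (z i)) (iInf_le_of_le ?_ ?_))
  · exact ⟨congrArg ψ h.1, congrArg ψ h.2⟩
  · exact Finset.sum_le_sum fun i _ => localDist_map_le hτ hψ _ _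

theorem map_mem_disk (hr : M.radius = M'.radius) {τ : E → Square ≃ₜ Square}
    (hτ : ∀ e x, (M'.coord e (τ e x) : E3) = M.coord e x) {ψ : S → S}
    (hψ : ∀ e x, ψ (D.chart e x) = D.chart e (τ e x)) {f : F} {p : S} (hp : p ∈ M.disk f) :
    ψ p ∈ M'.disk f := by
  obtain ⟨e, s, x, hf, rfl, h⟩ := hp
  refine ⟨e, s, τ e x, hf, (hψ e x).symm, ?_⟩
  rw [hτ, ← hr]
  exact h

theorem map_range_chart {τ : E → Square ≃ₜ Square} {ψ : S → S}
    (hψ : ∀ e x, ψ (D.chart e x) = D.chart e (τ e x)) (e : E) :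
    ψ '' Set.range (D.chart e) = Set.range (D.chart e) := by
  ext p
  constructor
  · rintro ⟨_, ⟨x, rfl⟩, rfl⟩
    exact ⟨τ e x, (hψ e x).symm⟩
  · rintro ⟨x, rfl⟩
    exact ⟨_, ⟨(τ e).symm x, rfl⟩, by rw [hψ, Homeomorph.apply_symm_apply]⟩

/-- Conical metrics with the same radii are isometric. -/
theorem isIsometric_of_radius_eq [Finite E] [T2Space S]
    (hΦ : ∀ e, 0 < Φ e ∧ Φ e < Real.pi / 2) (hr : M.radius = M'.radius) : M.IsIsometric M' := by
  obtain ⟨τ, hτ⟩ := exists_coord_transfer hr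
  have hτ' : ∀ e x, (M.coord e ((τ e).symm x) : E3) = M'.coord e x := by
    intro e x
    rw [← hτ, Homeomorph.apply_symm_apply]
  obtain ⟨ψ, hψc, hψ⟩ := exists_transfer_map hΦ hr hτ
  obtain ⟨χ, hχc, hχ⟩ := exists_transfer_map hΦ hr.symm (τ := fun e => (τ e).symm) hτ'
  have hχψ : ∀ p, χ (ψ p) = p := by
    intro p
    obtain ⟨e, x, rfl⟩ := D.chart_surjective p
    rw [hψ, hχ, Homeomorph.symm_apply_apply]
  have hψχ : ∀ p, ψ (χ p) = p := by
    intro p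
    obtain ⟨e, x, rfl⟩ := D.chart_surjective p
    rw [hχ, hψ, Homeomorph.apply_symm_apply]
  refine ⟨hr, ⟨⟨ψ, χ, hχψ, hψχ⟩, hψc, hχc⟩, fun p q => ?_, fun f => ?_, fun e => ?_,
    fun e s t => ?_, fun e s t => ?_⟩
  · refine le_antisymm (dist_map_le hτ hψ p q) ?_
    have := dist_map_le (τ := fun e => (τ e).symm) hτ' hχ (ψ p) (ψ q)
    rwa [hχψ, hχψ] at this
  · refine Set.Subset.antisymm ?_ fun p hp => ?_
    · rintro _ ⟨p, hp, rfl⟩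
      exact map_mem_disk hr hτ hψ hp
    · exact ⟨χ p, map_mem_disk hr.symm (τ := fun e => (τ e).symm) hτ' hχ hp, hψχ p⟩
  · exact map_range_chart hψ e
  · refine (hψ e _).trans ?_
    rw [transfer_leg hΦ hr hτ (c' := 0)]
    rw [legAngle_zero, legAngle_zero]
  · refine (hψ e _).trans ?_
    rw [transfer_leg hΦ hr hτ (c' := 1) (legAngle_one_eq hr e s t).symm]

/-! ### Total curvatures of conical metrics -/

/-- Geodesic curvatures of the circles. -/
def geodesicCurvature (M : ConicalMetric D Φ) (f : F) : ℝ := Real.cot (M.radius f)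

theorem sin_radius_pos (M : ConicalMetric D Φ) (f : F) : 0 < Real.sin (M.radius f) :=
  sin_pos_of_pos_of_le ⟨M.radius_pos f, M.radius_le f⟩

theorem geodesicCurvature_nonneg (M : ConicalMetric D Φ) (f : F) : 0 ≤ M.geodesicCurvature f := by
  rw [geodesicCurvature, Real.cot_eq_cos_div_sin]
  exact div_nonneg (cos_nonneg_of_pos_of_le ⟨M.radius_pos f, M.radius_le f⟩)
    (M.sin_radius_pos f).le

theorem radius_eq_pi_div_two_sub_arctan (M : ConicalMetric D Φ) (f : F) :
    M.radius f = Real.pi / 2 - Real.arctan (M.geodesicCurvature f) := by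
  have h : M.geodesicCurvature f = Real.tan (Real.pi / 2 - M.radius f) := by
    rw [geodesicCurvature, Real.cot_eq_cos_div_sin, Real.tan_eq_sin_div_cos,
      Real.sin_pi_div_two_sub, Real.cos_pi_div_two_sub]
  have h1 := M.radius_pos f
  have h2 := M.radius_le f
  rw [h, Real.arctan_tan (by linarith [Real.pi_pos]) (by linarith)]
  ring

theorem geodesicCurvature_eq_zero_iff (M : ConicalMetric D Φ) (f : F) :
    M.geodesicCurvature f = 0 ↔ M.radius f = Real.pi / 2 := by
  rw [radius_eq_pi_div_two_sub_arctan, sub_eq_self, Real.arctan_eq_zero_iff]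

theorem totalCurvature_eq_curvatureMap [Fintype E] (hΦ : ∀ e, 0 < Φ e ∧ Φ e < Real.pi / 2)
    (M : ConicalMetric D Φ) :
    M.totalCurvature = curvatureMap D.face Φ M.geodesicCurvature := by
  funext f
  refine Finset.sum_congr rfl fun e _ => Finset.sum_congr rfl fun s _ => ?_
  rw [sideCurvature_eq_sideTotal (sin_weight_pos hΦ e) (M.sin_radius_pos _) (M.sin_radius_pos _)]
  rfl

/-- Conical metrics with the same total curvatures have the same radii. -/
theorem radius_eq_of_totalCurvature_eq [Fintype E] [Fintype F]
    (hΦ : ∀ e, 0 < Φ e ∧ Φ e < Real.pi / 2) (h : M.totalCurvature = M'.totalCurvature) :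
    M.radius = M'.radius := by
  rw [totalCurvature_eq_curvatureMap hΦ, totalCurvature_eq_curvatureMap hΦ] at h
  have := curvatureMap_injOn hΦ D.face_surjective M.geodesicCurvature_nonneg
    M'.geodesicCurvature_nonneg fun f => congrFun h f
  funext f
  rw [radius_eq_pi_div_two_sub_arctan, radius_eq_pi_div_two_sub_arctan, this]

theorem exists_geodesicCurvature_eq (D : CellDecomposition S E F)
    (hΦ : ∀ e, 0 < Φ e ∧ Φ e < Real.pi / 2) {k : F → ℝ} (hk : ∀ f, 0 ≤ k f) :
    ∃ M : ConicalMetric D Φ, M.geodesicCurvature = k := by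
  refine ⟨ofRadius D hΦ (fun f => Real.pi / 2 - Real.arctan (k f)) fun f => ⟨?_, ?_⟩, ?_⟩
  · linarith [Real.arctan_lt_pi_div_two (k f)]
  · linarith [Real.arctan_nonneg.2 (hk f)]
  · funext f
    show Real.cot (Real.pi / 2 - Real.arctan (k f)) = k f
    rw [Real.cot_eq_cos_div_sin, Real.cos_pi_div_two_sub, Real.sin_pi_div_two_sub,
      ← Real.tan_eq_sin_div_cos, Real.tan_arctan]

/-! ### Both directions of the criterion -/

theorem totalCurvature_mem [Fintype E] [Fintype F]
    (hΦ : ∀ e, 0 < Φ e ∧ Φ e < Real.pi / 2) (hM : M.IsDegenerated) :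
    M.totalCurvature ∈ degeneratedCurvatureSet D Φ := by
  classical
  have hk := M.geodesicCurvature_nonneg
  obtain ⟨f₀, hf₀⟩ := hM
  rw [← geodesicCurvature_eq_zero_iff] at hf₀
  rw [totalCurvature_eq_curvatureMap hΦ]
  set k := M.geodesicCurvature
  -- The support of the curvature vector; the hemisphere f₀ lies outside it, so it is a proper
  -- subset.
  let I : Finset F := Finset.univ.filter fun f => 0 < k f
  have hI : ∀ f, f ∉ I → k f = 0 := fun f hf =>
    le_antisymm (not_lt.1 fun h => hf (by simpa [I] using h)) (hk f)
  rcases I.eq_empty_or_nonempty with h | h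
  · right
    funext f
    exact curvatureMap_eq_zero (hI f (by simp [h]))
  · left
    refine Set.mem_iUnion₂.2 ⟨I, ⟨h, fun hu => ?_⟩, fun f hf => curvatureMap_eq_zero (hI f hf),
      fun f hf => ?_, fun F' _ hF' => sum_curvatureMap_lt hΦ D.face_surjective hk hF'⟩
    · have : f₀ ∈ I := hu ▸ Finset.mem_univ f₀
      simp [I, hf₀] at this
    · exact curvatureMap_pos D.face_surjective hk (by simpa [I] using hf)

theorem exists_of_mem [Fintype E] [Fintype F] [Nonempty F]
    (hΦ : ∀ e, 0 < Φ e ∧ Φ e < Real.pi / 2) {L : F → ℝ} (hL : L ∈ degeneratedCurvatureSet D Φ) :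
    ∃ M : ConicalMetric D Φ, M.IsDegenerated ∧ M.totalCurvature = L := by
  classical
  -- The inequalities are extended from subsets of I to all nonempty F': only F' ∩ I contributes on
  -- the left, while enlarging F' ∩ I to F' can only add positive weights on the right.
  have hadm : (∀ f, 0 ≤ L f) ∧ (∃ f, L f = 0) ∧
      ∀ F' : Finset F, F'.Nonempty → ∑ f ∈ F', L f < 2 * ∑ e ∈ edgesWith D.face F', Φ e := by
    have hpos : ∀ F' : Finset F, F'.Nonempty → 0 < 2 * ∑ e ∈ edgesWith D.face F', Φ e :=
      fun F' h => mul_pos two_pos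
        (Finset.sum_pos (fun e _ => (hΦ e).1) (edgesWith_nonempty D.face_surjective h))
    rcases hL with hL | hL
    · obtain ⟨I, ⟨-, hI⟩, h0, hp, hlt⟩ := Set.mem_iUnion₂.1 hL
      have hI' : ∃ f, f ∉ I := by
        by_contra! h
        exact hI (Finset.eq_univ_of_forall h)
      refine ⟨fun f => ?_, hI'.imp h0, fun F' hF' => ?_⟩
      · by_cases hf : f ∈ I
        · exact (hp f hf).le
        · exact (h0 f hf).ge
      have hsum : ∑ f ∈ F', L f = ∑ f ∈ F'.filter (· ∈ I), L f := by
        rw [Finset.sum_filter]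
        refine Finset.sum_congr rfl fun f _ => ?_
        split_ifs with hf
        · rfl
        · exact h0 f hf
      rw [hsum]
      rcases (F'.filter (· ∈ I)).eq_empty_or_nonempty with he | hne
      · rw [he, Finset.sum_empty]; exact hpos F' hF'
      · refine (hlt _ (fun f hf => (Finset.mem_filter.1 hf).2) hne).trans_le ?_
        refine mul_le_mul_of_nonneg_left (Finset.sum_le_sum_of_subset_of_nonneg ?_
          fun e _ _ => (hΦ e).1.le) two_pos.le
        intro e he
        simp only [edgesOf, edgesWith, Finset.mem_filter, Finset.mem_univ, true_and] at he ⊢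
        exact he.imp fun s hs => hs.1
    · rw [Set.mem_singleton_iff.1 hL]
      exact ⟨fun _ => le_rfl, ⟨Classical.arbitrary F, rfl⟩, fun F' h => by simpa using hpos F' h⟩
  obtain ⟨h0, ⟨f, hf⟩, hlt⟩ := hadm
  obtain ⟨k, hk, hkL⟩ := exists_curvatureMap_eq hΦ h0 hlt
  obtain ⟨M, hM⟩ := exists_geodesicCurvature_eq D hΦ hk
  refine ⟨M, ⟨f, ?_⟩, ?_⟩
  · rw [← geodesicCurvature_eq_zero_iff, hM]
    -- A positive k f would make the curvature at f positive, whereas L f = 0; so the zero of L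
    -- produces a disk of radius π/2.
    by_contra hne
    have := curvatureMap_pos (Φ := Φ) D.face_surjective hk (lt_of_le_of_ne (hk f) (Ne.symm hne))
    rw [hkL, hf] at this
    exact this.false
  · rw [totalCurvature_eq_curvatureMap hΦ, hM]
    exact funext hkL

end

end ConicalMetric

end SphericalPattern

end

theorem theorem1p5 {S : Type*} [TopologicalSpace S] [CompactSpace S] [T2Space S] [Nonempty S]
    [ChartedSpace (EuclideanSpace ℝ (Fin 2)) S] {E F : Type*} [Fintype E] [Fintype F]
    (D : SphericalPattern.CellDecomposition S E F)
    (Φ : E → ℝ) (hΦ : ∀ e, 0 < Φ e ∧ Φ e < Real.pi / 2) (L : F → ℝ) :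
    ((∃ M : SphericalPattern.ConicalMetric D Φ, M.IsDegenerated ∧ M.totalCurvature = L) ↔
      L ∈ SphericalPattern.degeneratedCurvatureSet D Φ) ∧
    ∀ M M' : SphericalPattern.ConicalMetric D Φ,
      M.IsDegenerated → M.totalCurvature = L → M'.IsDegenerated → M'.totalCurvature = L →
      M.IsIsometric M' := by
  -- The vector 0 is realized by a degenerated metric only if there is some 2-cell; nonemptiness of
  -- S provides one.
  have : Nonempty F := by
    obtain ⟨e, -, -⟩ := D.chart_surjective (Classical.arbitrary S)
    exact ⟨D.face e true⟩
  refine ⟨⟨?_, SphericalPattern.ConicalMetric.exists_of_mem hΦ⟩, fun M M' _ hL _ hL' => ?_⟩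
  · rintro ⟨M, hM, rfl⟩
    exact SphericalPattern.ConicalMetric.totalCurvature_mem hΦ hM
  · exact SphericalPattern.ConicalMetric.isIsometric_of_radius_eq hΦ
      (SphericalPattern.ConicalMetric.radius_eq_of_totalCurvature_eq hΦ (hL.trans hL'.symm))
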